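/- **Setting.** Let $(\mathcal X,\mathfrak S)$ be a measurable space, $P_0,P_1$ probability distributions on it, $\pi_0,\pi_1\ge 0$, and $$\tilde P_0=(1-\pi_0)P_0+\pi_0P_1,\qquad \tilde P_1=(1-\pi_1)P_1+\pi_1P_0 .$$ One observes independent samples $Z_0^m\sim\tilde P_0^{\otimes m}$ and $Z_1^n\sim\tilde P_1^{\otimes n}$. A classifier is a measurable function $f:\mathcal X\to\{0,1\}$. Put $R_0(f)=P_0(f=1)$, $R_1(f)=P_1(f=0)$, $R(f)=\max\{R_0(f),R_1(f)\}$ and $R^*=\inf_f R(f)$, the infimum over all classifiers (the minmax error). A distribution $G$ is irreducible with respect to $H$ if there is no decomposition $G=\gamma H+(1-\gamma)F'$ with $F'$ a probability distribution and $0<\gamma\le 1$. For a probability distribution $Q$, call a set $\mathcal F$ of classifiers $Q$-measurable if for all $n$ and $e\in\mathbb R^n$ the map $x\mapsto\sup_{f\in\mathcal F}|\sum_{i=1}^n e_i f(x_i)|$ on $\mathcal X^n$ is measurable for the completion of $Q^{\otimes n}$ (every countable set of classifiers is $Q$-measurable). Call a sequence $(\mathcal F_k)$ of sets of classifiers universally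 approximating if $\lim_{k\to\infty}\inf_{f\in\mathcal F_k}Q(f\ne g)=0$ for every probability distribution $Q$ and every classifier $g$ (with $\inf\emptyset=\infty$). **Estimators.** Write $\widehat{\tilde R}_0(f)=\frac1m\sum_{i}\mathbf 1\{f(X_0^i)\neq 0\}$ and $\widehat{\tilde R}_1(f)=\frac1n\sum_{i}\mathbf 1\{f(X_1^i)\neq 1\}$. Let $(\mathcal G_j)_{j\ge1}$ be a universally approximating sequence of sets of classifiers, each $\tilde P_0$- and $\tilde P_1$-measurable and of finite VC dimension $W_j$, and let $\delta(m,n)\in(0,1]$ satisfy $\delta(m,n)\to0$ and $\log(1/\delta(m,n))/\min(m,n)\to0$ as $\min(m,n)\to\infty$. With $\varepsilon_m(W,\delta)=3\sqrt{(W\log(m+1)-\log(\delta/2))/m}$, the mixture proportion estimator (of Blanchard, Lee and Scott) for samples $Z_F^m,Z_H^n$ is $$\hat\nu(Z_F^m,Z_H^n)=\min\Big\{1,\ \inf_{j\ge1}\ \inf_{f\in\mathcal G_j}\frac{\hat F(f=1)+\varepsilon_m\big(W_j,\delta(m,n)j^{-2}\big)}{\big(\hat H(f=1)-\varepsilon_n\big(W_j,\delta(m,n)j^{-2}\big)\big)_+}\Big\},$$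 where $\hat F,\hat H$ are the empirical distributions and a ratio with denominator $0$ is $+\infty$. Put $\hat p_0=\hat\nu(Z_0^m,Z_1^n)$, $\hat p_1=\hat\nu(Z_1^n,Z_0^m)$ and $$\hat R_0(f)=1-\widehat{\tilde R}_1(f)-\frac{1-\widehat{\tilde R}_0(f)-\widehat{\tilde R}_1(f)}{1-\hat p_0},\qquad \hat R_1(f)=1-\widehat{\tilde R}_0(f)-\frac{1-\widehat{\tilde R}_1(f)-\widehat{\tilde R}_0(f)}{1-\hat p_1},$$ and $\hat R(f)=\max\{\hat R_0(f),\hat R_1(f)\}$. **Theorem.** Let $(\mathcal F_k)_{k\ge1}$ be sets of classifiers, each $\tilde P_0$- and $\tilde P_1$-measurable and of finite VC dimension $V_k$. Let $k(m,n)\in\mathbb N$ satisfy $k(m,n)\to\infty$ and $$\frac{V_{k(m,n)}\log(\min(m,n))}{\min(m,n)}\to0\qquad\text{as }\min(m,n)\to\infty .$$ Let $\tau_k>0$, $\tau_k\to0$, and for $k=k(m,n)$ and $m,n\ge 1$ let $\hat f_k$ be any classifier, depending on the samples, with $$\hat f_k\in\Big\{f\in\mathcal F_k:\ \hat R(f)\le\inf_{g\in\mathcal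 F_k}\hat R(g)+\tau_k\Big\}$$ whenever $\hat p_0<1$ and $\hat p_1<1$ (it is arbitrary on samples where $\hat p_0=1$ or $\hat p_1=1$). Assume - (A) $\pi_0+\pi_1<1$; - (C) $P_0$ and $P_1$ are mutually irreducible, i.e. each is irreducible with respect to the other; - (D) $(\mathcal F_k)$ is universally approximating. Then $R(\hat f_{k(m,n)})\to R^*$ in probability as $\min(m,n)\to\infty$: for every $\varepsilon>0$, the (outer) probability under $\tilde P_0^{\otimes m}\otimes\tilde P_1^{\otimes n}$ that $|R(\hat f_{k(m,n)})-R^*|\ge\varepsilon$ tends to $0$. -/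

import Mathlib

open MeasureTheory Filter Topology

namespace LabelNoise

/-- A classifier is a measurable function to `{0, 1}`. -/
def Classifier (X : Type*) [MeasurableSpace X] : Type _ := {f : X → Fin 2 // Measurable f}

/-- The limiting regime `min(m, n) → ∞` for pairs of sample sizes. -/
def minAtTop : Filter (ℕ × ℕ) := comap (fun p : ℕ × ℕ => min p.1 p.2) atTop

noncomputable section

/-! ### Distributions -/

/-- The mixture `(1 - π) P + π Q`. -/
def mixture {X : Type*} [MeasurableSpace X] (π : ℝ) (P Q : Measure X) : Measure X :=
  ENNReal.ofReal (1 - π) • P + ENNReal.ofReal π • Q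

/-- `G` is irreducible with respect to `H`: there is no decomposition
`G = γ H + (1 - γ) F'` with `F'` a probability distribution and `0 < γ ≤ 1`. -/
def IrreducibleWrt {X : Type*} [MeasurableSpace X] (G H : Measure X) : Prop :=
  ¬ ∃ (γ : ℝ) (F' : Measure X), 0 < γ ∧ γ ≤ 1 ∧ IsProbabilityMeasure F' ∧ G = mixture γ F' H

def MutuallyIrreducible {X : Type*} [MeasurableSpace X] (G H : Measure X) : Prop :=
  IrreducibleWrt G H ∧ IrreducibleWrt H G

/-! ### True errors -/

/-- Type I error `R₀(f) = P₀(f(X) = 1)`. -/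
def typeIError {X : Type*} [MeasurableSpace X] (P₀ : Measure X) (f : Classifier X) : ℝ :=
  P₀.real {x | f.1 x = 1}

/-- Type II error `R₁(f) = P₁(f(X) = 0)`. -/
def typeIIError {X : Type*} [MeasurableSpace X] (P₁ : Measure X) (f : Classifier X) : ℝ :=
  P₁.real {x | f.1 x = 0}

/-- The max error `R(f) = max {R₀(f), R₁(f)}`. -/
def maxError {X : Type*} [MeasurableSpace X] (P₀ P₁ : Measure X) (f : Classifier X) : ℝ :=
  max (typeIError P₀ f) (typeIIError P₁ f)

/-- The minmax error `R*`: the infimum of the max error over all classifiers. -/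
def minmaxError {X : Type*} [MeasurableSpace X] (P₀ P₁ : Measure X) : ℝ :=
  ⨅ f : Classifier X, maxError P₀ P₁ f

/-! ### Classes of classifiers -/

/-- The class `𝓕` shatters the finite set `S`. -/
def Shatters {X : Type*} [MeasurableSpace X] (𝓕 : Set (Classifier X)) (S : Finset X) : Prop :=
  ∀ T ⊆ S, ∃ f ∈ 𝓕, ∀ x ∈ S, f.1 x = 1 ↔ x ∈ T

/-- The VC dimension: the supremum of the sizes of shattered finite sets (possibly `⊤`). -/
def vcDim {X : Type*} [MeasurableSpace X] (𝓕 : Set (Classifier X)) : ℕ∞ :=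
  ⨆ (S : Finset X) (_ : Shatters 𝓕 S), (S.card : ℕ∞)

/-- Universal approximation property. The infimum is taken in `[0, ∞]`, so that the infimum over
an empty class is `∞`. -/
def UniversalApproximation {X : Type*} [MeasurableSpace X] (𝓕 : ℕ → Set (Classifier X)) : Prop :=
  ∀ Q : Measure X, IsProbabilityMeasure Q → ∀ g : Classifier X,
    Tendsto (fun k => ⨅ f ∈ 𝓕 k, Q {x | f.1 x ≠ g.1 x}) atTop (𝓝 0)

/-- `𝓕` is a `Q`-measurable class, in the usual sense of empirical process theory: for all `n` and
all real weights `e₁, …, eₙ` the function `(x₁, …, xₙ) ↦ sup_{f ∈ 𝓕} |∑ᵢ eᵢ f(xᵢ)|` is measurable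
for the completion of `Qⁿ`. Every countable class satisfies this. -/
def IsMeasurableClass {X : Type*} [MeasurableSpace X] (Q : Measure X)
    (𝓕 : Set (Classifier X)) : Prop :=
  ∀ (n : ℕ) (e : Fin n → ℝ),
    AEMeasurable (fun x : Fin n → X => ⨆ f : 𝓕, |∑ i, if f.1.1 (x i) = 1 then e i else 0|)
      (Measure.pi fun _ : Fin n => Q)

/-! ### Estimators -/

/-- The fraction of sample points that receive label `y`. -/
def empFreq {X : Type*} [MeasurableSpace X] {n : ℕ} (f : Classifier X) (y : Fin 2)
    (z : Fin n → X) : ℝ :=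
  (1 / (n : ℝ)) * ∑ i, if f.1 (z i) = y then (1 : ℝ) else 0

/-- The VC confidence radius `3 √((V log(n+1) - log(δ/2)) / n)`, for a class of VC dimension `V`,
a sample of size `n` and a confidence level `1 - δ`. -/
def vcRadius (V n : ℕ) (δ : ℝ) : ℝ :=
  3 * √(((V : ℝ) * Real.log ((n : ℝ) + 1) - Real.log (δ / 2)) / (n : ℝ))

/-- The mixture proportion estimator of Blanchard, Lee and Scott for `ν*(F, H)`, from a sample
`zF` of `F` and a sample `zH` of `H`, built on a sequence of classes `𝓖 j` and a level `δ`: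
the infimum over `j` and over `f ∈ 𝓖 j` of
`(F̂(f = 1) + ε_m) / (Ĥ(f = 1) - ε_n)₊`, where the radii are those of `𝓖 j` at level `δ / (j+1)²`,
a ratio with denominator `0` is `∞`, and the result is truncated at `1`.
(The numerators are positive when `m ≥ 1` and `0 < δ ≤ 1`.) -/
def mpe {X : Type*} [MeasurableSpace X] (𝓖 : ℕ → Set (Classifier X)) (δ : ℝ) {m n : ℕ}
    (zF : Fin m → X) (zH : Fin n → X) : ℝ :=
  (min 1 (⨅ j : ℕ, ⨅ f ∈ 𝓖 j,
    ENNReal.ofReal (empFreq f 1 zF + vcRadius (vcDim (𝓖 j)).toNat m (δ / ((j : ℝ) + 1) ^ 2)) /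
      ENNReal.ofReal
        (empFreq f 1 zH - vcRadius (vcDim (𝓖 j)).toNat n (δ / ((j : ℝ) + 1) ^ 2)))).toReal

/-- The estimate of the Type I error, from the two samples and an estimate `p₀` of the modified
contamination proportion. -/
def estTypeIError {X : Type*} [MeasurableSpace X] (p₀ : ℝ) {m n : ℕ} (z₀ : Fin m → X)
    (z₁ : Fin n → X) (f : Classifier X) : ℝ :=
  1 - empFreq f 0 z₁ - (1 - empFreq f 1 z₀ - empFreq f 0 z₁) / (1 - p₀)

/-- The estimate of the Type II error, from the two samples and an estimate `p₁` of the modified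
contamination proportion. -/
def estTypeIIError {X : Type*} [MeasurableSpace X] (p₁ : ℝ) {m n : ℕ} (z₀ : Fin m → X)
    (z₁ : Fin n → X) (f : Classifier X) : ℝ :=
  1 - empFreq f 1 z₀ - (1 - empFreq f 0 z₁ - empFreq f 1 z₀) / (1 - p₁)

/-- The estimated max error. -/
def estMaxError {X : Type*} [MeasurableSpace X] (p₀ p₁ : ℝ) {m n : ℕ} (z₀ : Fin m → X)
    (z₁ : Fin n → X) (f : Classifier X) : ℝ :=
  max (estTypeIError p₀ z₀ z₁ f) (estTypeIIError p₁ z₀ z₁ f)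

/-- The `τ`-approximate minimizers over `𝓕` of the estimated max error. -/
def approxMinimizers {X : Type*} [MeasurableSpace X] (𝓕 : Set (Classifier X)) (τ p₀ p₁ : ℝ)
    {m n : ℕ} (z₀ : Fin m → X) (z₁ : Fin n → X) : Set (Classifier X) :=
  {f ∈ 𝓕 | estMaxError p₀ p₁ z₀ z₁ f ≤ sInf (estMaxError p₀ p₁ z₀ z₁ '' 𝓕) + τ}

end

end LabelNoise

namespace LabelNoise

/-! ### The growth function of a class -/

/-! Put κ₀ = π₀/(1-π₁) and κ₁ = π₁/(1-π₀); both are below 1 by (A). Eliminating P₁ from the two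
mixture equations gives P̃₀ = (1-κ₀)P₀ + κ₀P̃₁, and symmetrically for P̃₁ (`real_mixture_eq`). Each
true error is therefore an explicit function of the two contaminated errors and of κ₀ or κ₁
(`real_eq_of_mixture`), and the estimated errors are its plug-in versions. Once the contaminated
errors are estimated uniformly over 𝓕_k and the κ's are estimated consistently, an approximate
minimizer is nearly optimal in 𝓕_k, and (D) brings the optimum over 𝓕_k down to R*.

The uniform estimates come from `vc_inequality`: an independent ghost sample replaces the true
probability (Jensen), random swaps of the two samples give a sub-Gaussian exponential moment for
each trace, and Sauer–Shelah bounds the number of traces. Markov's inequality is applied to a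
null-measurable majorant, so the bound covers outer probability.

For the proportions, P̃₀ ≥ κ₀P̃₁ keeps every ratio in the estimator above κ₀ when the samples are
uniformly close to their laws (`le_mpe`). In the other direction, irreducibility supplies sets whose
P₀-mass is negligible relative to their P₁-mass; there the ratio of P̃₀ to P̃₁ is almost κ₀
(`exists_classifier_mixture`). Universal approximation carries such a set into one fixed 𝓖_j, whose
confidence radii vanish (`eventually_abs_mpe_sub_le`). Everything else is deterministic on the event
of uniform closeness. -/

theorem Shatters.card_le_toNat_vcDim {X : Type*} [MeasurableSpace X] {𝓕 : Set (Classifier X)}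
    (hV : vcDim 𝓕 ≠ ⊤) {S : Finset X} (hS : Shatters 𝓕 S) : S.card ≤ (vcDim 𝓕).toNat := by
  have h : (S.card : ℕ∞) ≤ vcDim 𝓕 := le_iSup₂_of_le (f := fun (S : Finset X) (_ : Shatters 𝓕 S) =>
    (S.card : ℕ∞)) S hS le_rfl
  rw [← ENat.natCast_toNat hV] at h
  exact_mod_cast h

open Classical in
/-- The subsets of the index set that a class cuts out of a tuple of points. -/
noncomputable def traces {X ι : Type*} [MeasurableSpace X] [Fintype ι] (𝓕 : Set (Classifier X))
    (x : ι → X) : Finset (Finset ι) :=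
  Finset.univ.filter fun T => ∃ f ∈ 𝓕, ∀ i, f.1 (x i) = 1 ↔ i ∈ T

/-- Compare termwise with the binomial expansion of (N + 1)^V, using C(N,k) ≤ N^k ≤ N^k C(V,k) for k
≤ V. -/
theorem sum_choose_le_pow (N V : ℕ) : ∑ k ∈ Finset.Iic V, N.choose k ≤ (N + 1) ^ V := by
  rw [add_pow, Nat.range_succ_eq_Iic]
  refine Finset.sum_le_sum fun k hk => ?_
  calc N.choose k ≤ N ^ k := Nat.choose_le_pow N k
    _ ≤ N ^ k * 1 ^ (V - k) * V.choose k := by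
      rw [one_pow, mul_one]
      exact Nat.le_mul_of_pos_right _ (Nat.choose_pos (Finset.mem_Iic.1 hk))

open Classical in
/-- A form of the Sauer–Shelah lemma. -/
theorem card_traces_le {X ι : Type*} [MeasurableSpace X] [Fintype ι] {𝓕 : Set (Classifier X)}
    (hV : vcDim 𝓕 ≠ ⊤) (x : ι → X) :
    (traces 𝓕 x).card ≤ (Fintype.card ι + 1) ^ (vcDim 𝓕).toNat := by
  have hdim : (traces 𝓕 x).vcDim ≤ (vcDim 𝓕).toNat := by
    refine Finset.sup_le fun s hs => ?_
    rw [Finset.mem_shatterer] at hs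
    -- Indices carrying the same point receive the same label, so no trace can separate them. A
    -- shattered index set thus maps injectively to a shattered set of points.
    have hinj : Set.InjOn x s := by
      intro i hi j hj hij
      obtain ⟨u, hu, hsu⟩ := hs (Finset.singleton_subset_iff.2 hi)
      obtain ⟨f, -, hf⟩ := (Finset.mem_filter.1 hu).2
      have hiu : i ∈ u := by
        have : i ∈ s ∩ u := by rw [hsu]; exact Finset.mem_singleton_self i
        exact (Finset.mem_inter.1 this).2
      have hju : j ∈ u := (hf j).1 (hij ▸ (hf i).2 hiu)
      have : j ∈ s ∩ u := Finset.mem_inter.2 ⟨hj, hju⟩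
      rw [hsu] at this
      exact (Finset.mem_singleton.1 this).symm
    rw [← Finset.card_image_of_injOn hinj]
    refine Shatters.card_le_toNat_vcDim hV fun T _ => ?_
    obtain ⟨u, hu, hsu⟩ := hs (Finset.filter_subset (fun i => x i ∈ T) s)
    obtain ⟨f, hfF, hf⟩ := (Finset.mem_filter.1 hu).2
    refine ⟨f, hfF, fun y hy => ?_⟩
    obtain ⟨i, hi, rfl⟩ := Finset.mem_image.1 hy
    rw [hf i]
    have := congrArg (i ∈ ·) hsu
    simpa [hi] using this
  calc (traces 𝓕 x).card ≤ (traces 𝓕 x).shatterer.card := Finset.card_le_card_shatterer _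
    _ ≤ ∑ k ∈ Finset.Iic (traces 𝓕 x).vcDim, (Fintype.card ι).choose k :=
      Finset.card_shatterer_le_sum_vcDim
    _ ≤ (Fintype.card ι + 1) ^ (traces 𝓕 x).vcDim := sum_choose_le_pow _ _
    _ ≤ _ := Nat.pow_le_pow_right (Nat.succ_pos _) hdim

/-! ### Suprema of weighted sums -/

/-- The supremum over a class of the absolute weighted sums `|∑ᵢ eᵢ f(xᵢ)|`. -/
noncomputable def weightedSup {X ι : Type*} [MeasurableSpace X] [Fintype ι]
    (𝓕 : Set (Classifier X)) (e : ι → ℝ) (x : ι → X) : ℝ :=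
  ⨆ f : 𝓕, |∑ i, if f.1.1 (x i) = 1 then e i else 0|

theorem weightedSup_comp {X ι κ : Type*} [MeasurableSpace X] [Fintype ι] [Fintype κ]
    (𝓕 : Set (Classifier X)) (e : ι → ℝ) (x : ι → X) (σ : κ ≃ ι) :
    weightedSup 𝓕 (e ∘ σ) (x ∘ σ) = weightedSup 𝓕 e x := by
  refine iSup_congr fun f => ?_
  congr 1
  exact Equiv.sum_comp σ fun i => if f.1.1 (x i) = 1 then e i else 0

theorem measurePreserving_comp_equiv {X ι κ : Type*} [MeasurableSpace X] [Fintype ι] [Fintype κ]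
    (Q : Measure X) [SigmaFinite Q] (σ : κ ≃ ι) :
    MeasurePreserving (fun x : ι → X => x ∘ σ) (Measure.pi fun _ => Q) (Measure.pi fun _ => Q) :=
  measurePreserving_arrowCongr' (fun _ => Q) (fun _ => Q) σ.symm (MeasurableEquiv.refl X)
    fun _ => MeasurePreserving.id Q

theorem IsMeasurableClass.aemeasurable_weightedSup {X ι : Type*} [MeasurableSpace X] [Fintype ι]
    {Q : Measure X} [SigmaFinite Q] {𝓕 : Set (Classifier X)} (h : IsMeasurableClass Q 𝓕)
    (e : ι → ℝ) : AEMeasurable (weightedSup 𝓕 e) (Measure.pi fun _ : ι => Q) := by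
  have h1 : AEMeasurable (weightedSup 𝓕 (e ∘ (Fintype.equivFin ι).symm))
      (Measure.pi fun _ => Q) := h _ _
  have h2 := h1.comp_quasiMeasurePreserving
    (measurePreserving_comp_equiv Q (Fintype.equivFin ι).symm).quasiMeasurePreserving
  refine h2.congr (Eventually.of_forall fun x => ?_)
  exact weightedSup_comp 𝓕 e x _

/-- Permuting the weights amounts to permuting the points, which leaves the power of `Q` invariant.
This is the exchangeability behind symmetrization. -/
theorem lintegral_weightedSup_comp {X ι : Type*} [MeasurableSpace X] [Fintype ι]
    {Q : Measure X} [SigmaFinite Q] {𝓕 : Set (Classifier X)} (h : IsMeasurableClass Q 𝓕)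
    (e : ι → ℝ) (σ : Equiv.Perm ι) {φ : ℝ → ENNReal} (hφ : Measurable φ) :
    ∫⁻ x, φ (weightedSup 𝓕 (e ∘ σ) x) ∂(Measure.pi fun _ : ι => Q) =
      ∫⁻ x, φ (weightedSup 𝓕 e x) ∂(Measure.pi fun _ : ι => Q) := by
  have hm := measurePreserving_comp_equiv Q σ
  have hae : AEMeasurable (fun x => φ (weightedSup 𝓕 (e ∘ σ) x)) (Measure.pi fun _ : ι => Q) :=
    hφ.comp_aemeasurable (h.aemeasurable_weightedSup _)
  rw [← hm.map_eq] at hae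
  conv_lhs => rw [← hm.map_eq]
  rw [lintegral_map' hae hm.measurable.aemeasurable]
  simp only [weightedSup_comp]

theorem abs_weightedSum_le {X ι : Type*} [MeasurableSpace X] [Fintype ι] (e : ι → ℝ) (x : ι → X)
    (f : Classifier X) : |∑ i, if f.1 (x i) = 1 then e i else 0| ≤ ∑ i, |e i| := by
  refine (Finset.abs_sum_le_sum_abs _ _).trans (Finset.sum_le_sum fun i _ => ?_)
  split_ifs
  · exact le_rfl
  · simp

theorem abs_weightedSum_le_weightedSup {X ι : Type*} [MeasurableSpace X] [Fintype ι]
    {𝓕 : Set (Classifier X)} (e : ι → ℝ) (x : ι → X) {f : Classifier X} (hf : f ∈ 𝓕) :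
    |∑ i, if f.1 (x i) = 1 then e i else 0| ≤ weightedSup 𝓕 e x := by
  refine le_ciSup (f := fun f : 𝓕 => |∑ i, if f.1.1 (x i) = 1 then e i else 0|) ?_ ⟨f, hf⟩
  refine ⟨∑ i, |e i|, ?_⟩
  rintro _ ⟨g, rfl⟩
  exact abs_weightedSum_le e x g.1

open Classical in
-- The weighted sum depends on the classifier only through its trace, so the supremum runs over
-- finitely many values and is attained; the two exponentials cover both signs of the absolute
-- value. An empty class must be excluded: its real supremum is 0, while the right side is an empty
-- sum.
theorem exp_weightedSup_le {X ι : Type*} [MeasurableSpace X] [Fintype ι]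
    {𝓕 : Set (Classifier X)} (h𝓕 : 𝓕.Nonempty) (e : ι → ℝ) (x : ι → X) :
    Real.exp (weightedSup 𝓕 e x) ≤
      ∑ T ∈ traces 𝓕 x, (Real.exp (∑ i ∈ T, e i) + Real.exp (-∑ i ∈ T, e i)) := by
  have hne : Nonempty 𝓕 := h𝓕.to_subtype
  have hfin : (Set.range fun f : 𝓕 => |∑ i, if f.1.1 (x i) = 1 then e i else 0|).Finite := by
    refine (Set.finite_range fun T : Finset ι => |∑ i ∈ T, e i|).subset ?_
    rintro _ ⟨f, rfl⟩
    refine ⟨Finset.univ.filter fun i => f.1.1 (x i) = 1, ?_⟩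
    simp only [Finset.sum_filter]
  obtain ⟨f, hf⟩ := (Set.range_nonempty _).csSup_mem hfin
  have hsum : (∑ i, if f.1.1 (x i) = 1 then e i else 0) =
      ∑ i ∈ Finset.univ.filter (fun i => f.1.1 (x i) = 1), e i := by rw [Finset.sum_filter]
  have hT : Finset.univ.filter (fun i => f.1.1 (x i) = 1) ∈ traces 𝓕 x :=
    Finset.mem_filter.2 ⟨Finset.mem_univ _, f.1, f.2, by simp⟩
  have hw : weightedSup 𝓕 e x = |∑ i ∈ Finset.univ.filter (fun i => f.1.1 (x i) = 1), e i| := by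
    rw [← hsum]; exact hf.symm
  rw [hw]
  refine le_trans ?_ (Finset.single_le_sum
    (f := fun T => Real.exp (∑ i ∈ T, e i) + Real.exp (-∑ i ∈ T, e i))
    (fun T _ => by positivity) hT)
  rcases abs_choice (∑ i ∈ Finset.univ.filter (fun i => f.1.1 (x i) = 1), e i) with h | h <;> rw [h]
  · exact le_add_of_nonneg_right (Real.exp_pos _).le
  · exact le_add_of_nonneg_left (Real.exp_pos _).le

/-! ### Symmetrization -/

/-- The permutation of two copies of an index set that exchanges the copies of `i` if `s i`. -/
def swapPerm {ι : Type*} (s : ι → Bool) : Equiv.Perm (ι ⊕ ι) where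
  toFun := Sum.elim (fun i => if s i then Sum.inr i else Sum.inl i)
    (fun i => if s i then Sum.inl i else Sum.inr i)
  invFun := Sum.elim (fun i => if s i then Sum.inr i else Sum.inl i)
    (fun i => if s i then Sum.inl i else Sum.inr i)
  left_inv := by rintro (i | i) <;> by_cases h : s i <;> simp [h]
  right_inv := by rintro (i | i) <;> by_cases h : s i <;> simp [h]

/-- The weights `c` on the first and `-c` on the second copy of an index set. -/
def ghostWeight (ι : Type*) (c : ℝ) : ι ⊕ ι → ℝ := Sum.elim (fun _ => c) (fun _ => -c)

/-- Swaps act independently on the pairs, so the sum over all swaps factors into one hyperbolic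
cosine per pair, and cosh t ≤ exp(t²/2). -/
theorem sum_exp_ghostWeight_le {ι : Type*} [Fintype ι] [DecidableEq ι] (c : ℝ)
    (T : Finset (ι ⊕ ι)) :
    ∑ s : ι → Bool, Real.exp (∑ i ∈ T, (ghostWeight ι c ∘ swapPerm s) i) ≤
      2 ^ Fintype.card ι * Real.exp (Fintype.card ι * (c ^ 2 / 2)) := by
  -- The pair of copies of `i` contributes `c * d i`, and swapping it only changes the sign; `d i`
  -- is 0 or ±1.
  let d : ι → ℝ := fun i => (if Sum.inl i ∈ T then 1 else 0) - if Sum.inr i ∈ T then 1 else 0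
  have hd : ∀ i, d i ^ 2 ≤ 1 := by
    intro i
    simp only [d]
    split_ifs <;> norm_num
  have h1 : ∀ s : ι → Bool, Real.exp (∑ i ∈ T, (ghostWeight ι c ∘ swapPerm s) i) =
      ∏ i, Real.exp (if s i then -(c * d i) else c * d i) := by
    intro s
    rw [← Real.exp_sum, ← Finset.univ_inter T, ← Finset.sum_ite_mem, Fintype.sum_sum_type,
      ← Finset.sum_add_distrib]
    congr 1
    refine Finset.sum_congr rfl fun i _ => ?_
    by_cases hs : s i <;> simp only [Function.comp, swapPerm, ghostWeight, Equiv.coe_fn_mk,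
      Sum.elim_inl, Sum.elim_inr, hs, d] <;> split_ifs <;> simp_all
  have h2 : ∀ i, ∑ b : Bool, Real.exp (if b then -(c * d i) else c * d i) ≤
      2 * Real.exp (c ^ 2 / 2) := by
    intro i
    have h3 := Real.cosh_le_exp_half_sq (c * d i)
    have h4 : Real.exp ((c * d i) ^ 2 / 2) ≤ Real.exp (c ^ 2 / 2) := by
      refine Real.exp_le_exp.2 ?_
      rw [mul_pow]
      nlinarith [mul_le_mul_of_nonneg_left (hd i) (sq_nonneg c)]
    rw [Real.cosh_eq] at h3
    simp only [Fintype.sum_bool, if_true, Bool.false_eq_true, if_false]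
    linarith
  calc ∑ s : ι → Bool, Real.exp (∑ i ∈ T, (ghostWeight ι c ∘ swapPerm s) i)
      = ∑ s : ι → Bool, ∏ i, Real.exp (if s i then -(c * d i) else c * d i) :=
        Finset.sum_congr rfl fun s _ => h1 s
    _ = ∏ i, ∑ b : Bool, Real.exp (if b then -(c * d i) else c * d i) :=
        (Fintype.prod_sum fun i (b : Bool) => Real.exp (if b then -(c * d i) else c * d i)).symm
    _ ≤ ∏ _i : ι, 2 * Real.exp (c ^ 2 / 2) :=
        Finset.prod_le_prod (fun i _ => Finset.sum_nonneg fun b _ => (Real.exp_pos _).le)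
          fun i _ => h2 i
    _ = _ := by
        rw [Finset.prod_const, mul_pow, ← Real.exp_nat_mul, Finset.card_univ]

theorem ghostWeight_neg (ι : Type*) (c : ℝ) (s : ι → Bool) (i : ι ⊕ ι) :
    (ghostWeight ι (-c) ∘ swapPerm s) i = -(ghostWeight ι c ∘ swapPerm s) i := by
  rcases i with i | i <;> by_cases hs : s i <;> simp [swapPerm, ghostWeight, hs]

/-- For fixed points the traces do not depend on the swap, so the two sums can be exchanged:
Sauer–Shelah on twice as many points counts the traces, and each is averaged over the swaps. -/
theorem sum_exp_weightedSup_le {X ι : Type*} [MeasurableSpace X] [Fintype ι] [DecidableEq ι]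
    {𝓕 : Set (Classifier X)} (h𝓕 : 𝓕.Nonempty) (hV : vcDim 𝓕 ≠ ⊤) (c : ℝ) (x : ι ⊕ ι → X) :
    ∑ s : ι → Bool, Real.exp (weightedSup 𝓕 (ghostWeight ι c ∘ swapPerm s) x) ≤
      2 ^ Fintype.card ι * (2 * (2 * (Fintype.card ι : ℝ) + 1) ^ (vcDim 𝓕).toNat *
        Real.exp (Fintype.card ι * (c ^ 2 / 2))) := by
  have hT : ∀ T : Finset (ι ⊕ ι), ∑ s : ι → Bool,
      (Real.exp (∑ i ∈ T, (ghostWeight ι c ∘ swapPerm s) i) +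
        Real.exp (-∑ i ∈ T, (ghostWeight ι c ∘ swapPerm s) i)) ≤
      2 * (2 ^ Fintype.card ι * Real.exp (Fintype.card ι * (c ^ 2 / 2))) := by
    intro T
    have h1 := sum_exp_ghostWeight_le c T
    have h2 := sum_exp_ghostWeight_le (-c) T
    simp only [ghostWeight_neg, Finset.sum_neg_distrib, neg_sq] at h2
    rw [Finset.sum_add_distrib]
    linarith
  have hcard : ((traces 𝓕 x).card : ℝ) ≤ (2 * (Fintype.card ι : ℝ) + 1) ^ (vcDim 𝓕).toNat := by
    have := card_traces_le hV x
    rw [Fintype.card_sum, ← two_mul] at this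
    exact_mod_cast this
  calc ∑ s : ι → Bool, Real.exp (weightedSup 𝓕 (ghostWeight ι c ∘ swapPerm s) x)
      ≤ ∑ s : ι → Bool, ∑ T ∈ traces 𝓕 x,
          (Real.exp (∑ i ∈ T, (ghostWeight ι c ∘ swapPerm s) i) +
            Real.exp (-∑ i ∈ T, (ghostWeight ι c ∘ swapPerm s) i)) :=
        Finset.sum_le_sum fun s _ => exp_weightedSup_le h𝓕 _ x
    _ = ∑ T ∈ traces 𝓕 x, ∑ s : ι → Bool,
          (Real.exp (∑ i ∈ T, (ghostWeight ι c ∘ swapPerm s) i) +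
            Real.exp (-∑ i ∈ T, (ghostWeight ι c ∘ swapPerm s) i)) := Finset.sum_comm
    _ ≤ ∑ _T ∈ traces 𝓕 x, 2 * (2 ^ Fintype.card ι * Real.exp (Fintype.card ι * (c ^ 2 / 2))) :=
        Finset.sum_le_sum fun T _ => hT T
    _ = (traces 𝓕 x).card * (2 * (2 ^ Fintype.card ι * Real.exp (Fintype.card ι * (c ^ 2 / 2)))) :=
        by rw [Finset.sum_const, nsmul_eq_mul]
    _ ≤ (2 * (Fintype.card ι : ℝ) + 1) ^ (vcDim 𝓕).toNat *
          (2 * (2 ^ Fintype.card ι * Real.exp (Fintype.card ι * (c ^ 2 / 2)))) :=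
        mul_le_mul_of_nonneg_right hcard (by positivity)
    _ = _ := by ring

/-- The exponential moment of the symmetrized process. -/
theorem lintegral_exp_weightedSup_le {X ι : Type*} [MeasurableSpace X] [Fintype ι]
    {Q : Measure X} [IsProbabilityMeasure Q] {𝓕 : Set (Classifier X)} (h𝓕 : 𝓕.Nonempty)
    (hV : vcDim 𝓕 ≠ ⊤) (hm : IsMeasurableClass Q 𝓕) (c : ℝ) :
    ∫⁻ x, ENNReal.ofReal (Real.exp (weightedSup 𝓕 (ghostWeight ι c) x))
        ∂(Measure.pi fun _ : ι ⊕ ι => Q) ≤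
      ENNReal.ofReal (2 * (2 * (Fintype.card ι : ℝ) + 1) ^ (vcDim 𝓕).toNat *
        Real.exp (Fintype.card ι * (c ^ 2 / 2))) := by
  classical
  have hφ : Measurable fun t : ℝ => ENNReal.ofReal (Real.exp t) :=
    Real.measurable_exp.ennreal_ofReal
  set I := ∫⁻ x, ENNReal.ofReal (Real.exp (weightedSup 𝓕 (ghostWeight ι c) x))
        ∂(Measure.pi fun _ : ι ⊕ ι => Q) with hI
  set B := 2 * (2 * (Fintype.card ι : ℝ) + 1) ^ (vcDim 𝓕).toNat *
        Real.exp (Fintype.card ι * (c ^ 2 / 2)) with hB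
  have hs : ∀ s : ι → Bool, ∫⁻ x, ENNReal.ofReal
      (Real.exp (weightedSup 𝓕 (ghostWeight ι c ∘ swapPerm s) x))
        ∂(Measure.pi fun _ : ι ⊕ ι => Q) = I := fun s =>
    lintegral_weightedSup_comp hm (ghostWeight ι c) (swapPerm s) hφ
  have h2 : (2 : ENNReal) ^ Fintype.card ι * I ≤ 2 ^ Fintype.card ι * ENNReal.ofReal B := by
    calc (2 : ENNReal) ^ Fintype.card ι * I = ∑ s : ι → Bool, I := by
          rw [Finset.sum_const, Finset.card_univ, Fintype.card_fun, Fintype.card_bool, nsmul_eq_mul]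
          push_cast
          rfl
      _ = ∑ s : ι → Bool, ∫⁻ x, ENNReal.ofReal
            (Real.exp (weightedSup 𝓕 (ghostWeight ι c ∘ swapPerm s) x))
            ∂(Measure.pi fun _ : ι ⊕ ι => Q) := Finset.sum_congr rfl fun s _ => (hs s).symm
      _ = ∫⁻ x, ∑ s : ι → Bool, ENNReal.ofReal
            (Real.exp (weightedSup 𝓕 (ghostWeight ι c ∘ swapPerm s) x))
            ∂(Measure.pi fun _ : ι ⊕ ι => Q) :=
          (lintegral_finsetSum' _ fun s _ =>
            hφ.comp_aemeasurable (hm.aemeasurable_weightedSup _)).symm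
      _ ≤ ∫⁻ _x, ENNReal.ofReal (2 ^ Fintype.card ι * B) ∂(Measure.pi fun _ : ι ⊕ ι => Q) := by
          refine lintegral_mono fun x => ?_
          rw [← ENNReal.ofReal_sum_of_nonneg fun s _ => (Real.exp_pos _).le]
          exact ENNReal.ofReal_le_ofReal (sum_exp_weightedSup_le h𝓕 hV c x)
      _ = _ := by
          rw [lintegral_const, measure_univ, mul_one, ENNReal.ofReal_mul (by positivity),
            ENNReal.ofReal_pow (by norm_num), ENNReal.ofReal_ofNat]
  exact (ENNReal.mul_le_mul_iff_right (by positivity) (by finiteness)).1 h2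

/-! ### The Vapnik–Chervonenkis inequality -/

theorem integrable_empFreq {X : Type*} [MeasurableSpace X] (Q : Measure X) [IsProbabilityMeasure Q]
    {n : ℕ} (f : Classifier X) (y : Fin 2) :
    Integrable (fun z : Fin n → X => empFreq f y z) (Measure.pi fun _ => Q) := by
  refine Integrable.const_mul (integrable_finsetSum _ fun i _ => ?_) _
  have hS : MeasurableSet {z : Fin n → X | f.1 (z i) = y} :=
    (f.2.comp (measurable_pi_apply i)) (measurableSet_singleton y)
  exact Integrable.of_bound
    ((Measurable.ite hS measurable_const measurable_const).aestronglyMeasurable) 1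
    (Eventually.of_forall fun z => by split_ifs <;> simp)

theorem integral_empFreq {X : Type*} [MeasurableSpace X] (Q : Measure X) [IsProbabilityMeasure Q]
    {n : ℕ} (hn : 0 < n) (f : Classifier X) (y : Fin 2) :
    ∫ z : Fin n → X, empFreq f y z ∂(Measure.pi fun _ => Q) = Q.real {x | f.1 x = y} := by
  have hS : MeasurableSet {x : X | f.1 x = y} := f.2 (measurableSet_singleton y)
  have hm : Measurable fun x : X => if f.1 x = y then (1 : ℝ) else 0 :=
    Measurable.ite hS measurable_const measurable_const
  have hint : ∀ i : Fin n, Integrable (fun z : Fin n → X => if f.1 (z i) = y then (1 : ℝ) else 0)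
      (Measure.pi fun _ => Q) := fun i =>
    Integrable.of_bound ((hm.comp (measurable_pi_apply i)).aestronglyMeasurable) 1
      (Eventually.of_forall fun z => by split_ifs <;> simp)
  have h1 : ∀ i : Fin n, ∫ z : Fin n → X, (if f.1 (z i) = y then (1 : ℝ) else 0)
      ∂(Measure.pi fun _ => Q) = Q.real {x | f.1 x = y} := by
    intro i
    rw [integral_comp_eval (μ := fun _ : Fin n => Q) (i := i)
      (f := fun x => if f.1 x = y then (1 : ℝ) else 0) hm.aestronglyMeasurable]
    rw [← integral_indicator_one hS]
    exact integral_congr_ae (Eventually.of_forall fun x => by simp [Set.indicator_apply])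
  unfold empFreq
  rw [integral_const_mul, integral_finsetSum _ fun i _ => hint i]
  simp only [h1, Finset.sum_const, Finset.card_univ, Fintype.card_fin, nsmul_eq_mul]
  field_simp

theorem empFreq_nonneg {X : Type*} [MeasurableSpace X] {n : ℕ} (f : Classifier X) (y : Fin 2)
    (z : Fin n → X) : 0 ≤ empFreq f y z :=
  mul_nonneg (by positivity) (Finset.sum_nonneg fun i _ => by split_ifs <;> norm_num)

theorem empFreq_le_one {X : Type*} [MeasurableSpace X] {n : ℕ} (f : Classifier X) (y : Fin 2)
    (z : Fin n → X) : empFreq f y z ≤ 1 := by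
  have h : ∑ i, (if f.1 (z i) = y then (1 : ℝ) else 0) ≤ n := by
    calc ∑ i, (if f.1 (z i) = y then (1 : ℝ) else 0) ≤ ∑ _i : Fin n, (1 : ℝ) :=
          Finset.sum_le_sum fun i _ => by split_ifs <;> norm_num
      _ = n := by simp
  unfold empFreq
  rw [one_div_mul_eq_div]
  exact div_le_one_of_le₀ h (by positivity)

/-- Jensen's inequality for the deviation of an independent copy. -/
theorem exp_abs_sub_le_lintegral {X : Type*} [MeasurableSpace X] (Q : Measure X)
    [IsProbabilityMeasure Q] {n : ℕ} (hn : 0 < n) (f : Classifier X) (a l : ℝ) (hl : 0 ≤ l) :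
    ENNReal.ofReal (Real.exp (l * |a - Q.real {x | f.1 x = 1}|)) ≤
      ∫⁻ z : Fin n → X, ENNReal.ofReal (Real.exp (l * |a - empFreq f 1 z|))
        ∂(Measure.pi fun _ => Q) := by
  -- Fixing the sign of the mean deviation makes the exponent affine in the empirical frequency, so
  -- Jensen's inequality for `exp` suffices.
  obtain ⟨s, hs, hs'⟩ : ∃ s : ℝ, |a - Q.real {x | f.1 x = 1}| = s * (a - Q.real {x | f.1 x = 1}) ∧
      ∀ t, s * t ≤ |t| := by
    rcases abs_choice (a - Q.real {x | f.1 x = 1}) with h | h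
    · exact ⟨1, by rw [h, one_mul], fun t => by rw [one_mul]; exact le_abs_self t⟩
    · exact ⟨-1, by rw [h]; ring, fun t => by linarith [neg_le_abs t]⟩
  have hint : Integrable (fun z : Fin n → X => l * (s * (a - empFreq f 1 z)))
      (Measure.pi fun _ => Q) :=
    (((integrable_const a).sub (integrable_empFreq Q f 1)).const_mul s).const_mul l
  have hmean : ∫ z : Fin n → X, l * (s * (a - empFreq f 1 z)) ∂(Measure.pi fun _ => Q) =
      l * (s * (a - Q.real {x | f.1 x = 1})) := by
    rw [integral_const_mul, integral_const_mul, integral_sub (integrable_const a)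
      (integrable_empFreq Q f 1), integral_empFreq Q hn]
    simp
  have hexp : Integrable (fun z : Fin n → X => Real.exp (l * (s * (a - empFreq f 1 z))))
      (Measure.pi fun _ => Q) := by
    refine Integrable.of_bound (Real.continuous_exp.comp_aestronglyMeasurable
      hint.aestronglyMeasurable) (Real.exp (l * (|a| + 1))) (Eventually.of_forall fun z => ?_)
    rw [Real.norm_eq_abs, Real.abs_exp]
    refine Real.exp_le_exp.2 (mul_le_mul_of_nonneg_left ((hs' _).trans ?_) hl)
    refine (abs_sub _ _).trans (add_le_add le_rfl ?_)
    rw [abs_of_nonneg (empFreq_nonneg f 1 z)]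
    exact empFreq_le_one f 1 z
  have hJ := convexOn_exp.map_integral_le Real.continuous_exp.continuousOn isClosed_univ
    (Eventually.of_forall fun z => Set.mem_univ _) hint hexp
  rw [hmean, ← hs] at hJ
  refine (ENNReal.ofReal_le_ofReal hJ).trans ?_
  rw [ofReal_integral_eq_lintegral_ofReal hexp (Eventually.of_forall fun z => (Real.exp_pos _).le)]
  refine lintegral_mono fun z => ENNReal.ofReal_le_ofReal (Real.exp_le_exp.2 ?_)
  exact mul_le_mul_of_nonneg_left (hs' _) hl

theorem sum_ghostWeight_eq {X : Type*} [MeasurableSpace X] {n : ℕ} (hn : 0 < n) (f : Classifier X)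
    (c : ℝ) (x : Fin n ⊕ Fin n → X) :
    ∑ i, (if f.1 (x i) = 1 then ghostWeight (Fin n) c i else 0) =
      n * c * (empFreq f 1 (fun i => x (Sum.inl i)) - empFreq f 1 fun i => x (Sum.inr i)) := by
  have h : ∀ (z : Fin n → X) (d : ℝ), ∑ i, (if f.1 (z i) = 1 then d else 0) =
      n * d * empFreq f 1 z := by
    intro z d
    have hn' : (n : ℝ) ≠ 0 := by positivity
    have : ∀ i, (if f.1 (z i) = 1 then d else 0) = d * if f.1 (z i) = 1 then (1 : ℝ) else 0 :=
      fun i => by split_ifs <;> simp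
    simp only [this, ← Finset.mul_sum, empFreq]
    field_simp
  rw [Fintype.sum_sum_type]
  simp only [ghostWeight, Sum.elim_inl, Sum.elim_inr]
  rw [h (fun i => x (Sum.inl i)) c, h (fun i => x (Sum.inr i)) (-c)]
  ring

/-- The Vapnik–Chervonenkis inequality, for the outer probability of a uniform deviation. -/
theorem vc_inequality {X : Type*} [MeasurableSpace X] {Q : Measure X} [IsProbabilityMeasure Q]
    {𝓕 : Set (Classifier X)} (hV : vcDim 𝓕 ≠ ⊤) (hm : IsMeasurableClass Q 𝓕) {n : ℕ} (hn : 0 < n)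
    {ε : ℝ} (hε : 0 ≤ ε) :
    (Measure.pi fun _ : Fin n => Q)
        {z | ∃ f ∈ 𝓕, ε ≤ |empFreq f 1 z - Q.real {x | f.1 x = 1}|} ≤
      ENNReal.ofReal (2 * (2 * (n : ℝ) + 1) ^ (vcDim 𝓕).toNat * Real.exp (-(n * ε ^ 2 / 2))) := by
  rcases 𝓕.eq_empty_or_nonempty with rfl | h𝓕
  · simp
  set μ := Measure.pi fun _ : Fin n => Q
  set e := MeasurableEquiv.sumPiEquivProdPi fun _ : Fin n ⊕ Fin n => X
  have he : MeasurePreserving e (Measure.pi fun _ => Q) (μ.prod μ) :=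
    measurePreserving_sumPiEquivProdPi fun _ : Fin n ⊕ Fin n => Q
  -- The weight `ε` is the optimal Chernoff parameter: c = ε minimizes n(c²/2 - cε).
  set G : (Fin n → X) × (Fin n → X) → ENNReal := fun p =>
    ENNReal.ofReal (Real.exp (weightedSup 𝓕 (ghostWeight (Fin n) ε) (e.symm p)))
  have hG : AEMeasurable G (μ.prod μ) := by
    refine Real.measurable_exp.ennreal_ofReal.comp_aemeasurable ?_
    exact (hm.aemeasurable_weightedSup _).comp_quasiMeasurePreserving
      (he.symm e).quasiMeasurePreserving
  have hGint : ∫⁻ p, G p ∂(μ.prod μ) ≤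
      ENNReal.ofReal (2 * (2 * (n : ℝ) + 1) ^ (vcDim 𝓕).toNat * Real.exp (n * (ε ^ 2 / 2))) := by
    have h := lintegral_exp_weightedSup_le (ι := Fin n) h𝓕 hV hm ε
    rw [Fintype.card_fin] at h
    refine le_trans (le_of_eq ?_) h
    rw [he.lintegral_map_equiv]
    simp only [G, MeasurableEquiv.symm_apply_apply]
  have hsub : {z | ∃ f ∈ 𝓕, ε ≤ |empFreq f 1 z - Q.real {x | f.1 x = 1}|} ⊆
      {z | ENNReal.ofReal (Real.exp (n * ε ^ 2)) ≤ ∫⁻ z', G (z, z') ∂μ} := by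
    rintro z ⟨f, hf, hfε⟩
    have h1 := exp_abs_sub_le_lintegral Q hn f (empFreq f 1 z) (n * ε) (by positivity)
    refine le_trans ?_ (h1.trans ?_)
    · refine ENNReal.ofReal_le_ofReal (Real.exp_le_exp.2 ?_)
      calc (n : ℝ) * ε ^ 2 = n * ε * ε := by ring
        _ ≤ _ := mul_le_mul_of_nonneg_left hfε (by positivity)
    · refine lintegral_mono fun z' => ENNReal.ofReal_le_ofReal (Real.exp_le_exp.2 ?_)
      refine le_trans (le_of_eq ?_) (abs_weightedSum_le_weightedSup _ _ hf)
      rw [sum_ghostWeight_eq hn, abs_mul, abs_of_nonneg (by positivity : (0 : ℝ) ≤ n * ε)]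
      rfl
  have hmarkov : ENNReal.ofReal (Real.exp (n * ε ^ 2)) *
      μ {z | ENNReal.ofReal (Real.exp (n * ε ^ 2)) ≤ ∫⁻ z', G (z, z') ∂μ} ≤
      ENNReal.ofReal (2 * (2 * (n : ℝ) + 1) ^ (vcDim 𝓕).toNat * Real.exp (n * (ε ^ 2 / 2))) := by
    refine (mul_meas_ge_le_lintegral₀ hG.lintegral_prod_right' _).trans ?_
    rw [← lintegral_prod G hG]
    exact hGint
  refine (measure_mono hsub).trans ?_
  refine (ENNReal.mul_le_mul_iff_right
    (ENNReal.ofReal_pos.2 (Real.exp_pos (n * ε ^ 2))).ne' ENNReal.ofReal_ne_top).1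
    (hmarkov.trans (le_of_eq ?_))
  rw [← ENNReal.ofReal_mul (Real.exp_pos _).le, mul_left_comm, ← Real.exp_add]
  congr 3
  ring

/-! ### Confidence radii -/

theorem vcRadius_arg_pos (V : ℕ) {n : ℕ} (hn : 0 < n) {δ : ℝ} (hδ : 0 < δ) (hδ1 : δ ≤ 1) :
    0 < ((V : ℝ) * Real.log ((n : ℝ) + 1) - Real.log (δ / 2)) / (n : ℝ) := by
  have h1 : 0 ≤ Real.log ((n : ℝ) + 1) := Real.log_nonneg (by linarith [n.cast_nonneg (α := ℝ)])
  have h2 : Real.log (δ / 2) < 0 := Real.log_neg (by linarith) (by linarith)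
  have h3 : 0 ≤ (V : ℝ) * Real.log ((n : ℝ) + 1) := by positivity
  have : (0 : ℝ) < n := by exact_mod_cast hn
  exact div_pos (by linarith) this

theorem vcRadius_pos (V : ℕ) {n : ℕ} (hn : 0 < n) {δ : ℝ} (hδ : 0 < δ) (hδ1 : δ ≤ 1) :
    0 < vcRadius V n δ :=
  mul_pos (by norm_num) (Real.sqrt_pos.2 (vcRadius_arg_pos V hn hδ hδ1))

/-- Since 2n+1 ≤ (n+1)², the growth factor costs at most 2V log(n+1) in the exponent. The factor 3
in the radius yields 9/2 of both V log(n+1) and -log(δ/2), which is more than enough. -/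
theorem vcRadius_confidence (V : ℕ) {n : ℕ} (hn : 0 < n) {δ : ℝ} (hδ : 0 < δ) (hδ1 : δ ≤ 1) :
    2 * (2 * (n : ℝ) + 1) ^ V * Real.exp (-(n * vcRadius V n δ ^ 2 / 2)) ≤ δ := by
  have hn' : (0 : ℝ) < n := by exact_mod_cast hn
  have hr : n * vcRadius V n δ ^ 2 / 2 =
      9 / 2 * (V * Real.log ((n : ℝ) + 1) - Real.log (δ / 2)) := by
    rw [vcRadius, mul_pow, Real.sq_sqrt (vcRadius_arg_pos V hn hδ hδ1).le]
    field_simp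
    ring
  have h2 : Real.log (δ / 2) < 0 := Real.log_neg (by linarith) (by linarith)
  have h1 : 0 ≤ (V : ℝ) * Real.log ((n : ℝ) + 1) :=
    mul_nonneg V.cast_nonneg (Real.log_nonneg (by linarith))
  have hpow : (2 * (n : ℝ) + 1) ^ V ≤ Real.exp (2 * (V * Real.log ((n : ℝ) + 1))) := by
    have : Real.exp (2 * (V * Real.log ((n : ℝ) + 1))) = (((n : ℝ) + 1) ^ 2) ^ V := by
      rw [← Real.exp_log (show (0 : ℝ) < (n : ℝ) + 1 by linarith), ← Real.exp_nat_mul,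
        ← Real.exp_nat_mul, Real.log_exp]
      congr 1
      push_cast
      ring
    rw [this]
    exact pow_le_pow_left₀ (by linarith) (by nlinarith) V
  calc 2 * (2 * (n : ℝ) + 1) ^ V * Real.exp (-(n * vcRadius V n δ ^ 2 / 2))
      ≤ 2 * Real.exp (2 * (V * Real.log ((n : ℝ) + 1))) *
          Real.exp (-(n * vcRadius V n δ ^ 2 / 2)) := by gcongr
    _ = 2 * Real.exp (2 * (V * Real.log ((n : ℝ) + 1)) - n * vcRadius V n δ ^ 2 / 2) := by
        rw [mul_assoc, ← Real.exp_add, sub_eq_add_neg]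
    _ ≤ 2 * Real.exp (Real.log (δ / 2)) := by
        refine mul_le_mul_of_nonneg_left (Real.exp_le_exp.2 ?_) (by norm_num)
        rw [hr]
        linarith
    _ = δ := by
        rw [Real.exp_log (by linarith)]
        ring

theorem tendsto_vcRadius {α : Type*} {l : Filter α} {M : α → ℕ} {d : α → ℝ}
    (hM : Tendsto M l atTop) (hd : ∀ p, 0 < d p)
    (hlog : Tendsto (fun p => Real.log (1 / d p) / (M p : ℝ)) l (𝓝 0)) (V : ℕ) {c : ℝ}
    (hc : 0 < c) : Tendsto (fun p => vcRadius V (M p) (d p / c)) l (𝓝 0) := by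
  have hM' : Tendsto (fun p => (M p : ℝ)) l atTop := tendsto_natCast_atTop_atTop.comp hM
  have h1 : Tendsto (fun p => Real.log ((M p : ℝ) + 1) / (M p : ℝ)) l (𝓝 0) := by
    have h : Tendsto (fun x : ℝ => Real.log (x + 1) / x) atTop (𝓝 0) := by
      have h0 : Tendsto (fun x : ℝ => Real.log x / x) atTop (𝓝 0) := by
        simpa using Real.isLittleO_log_id_atTop.tendsto_div_nhds_zero
      have h0' := h0.comp (tendsto_atTop_add_const_right atTop (1 : ℝ) tendsto_id)
      have hinv : Tendsto (fun x : ℝ => (1 : ℝ) + x⁻¹) atTop (𝓝 (1 + 0)) :=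
        tendsto_const_nhds.add tendsto_inv_atTop_zero
      have := h0'.mul hinv
      rw [zero_mul] at this
      refine this.congr' ?_
      filter_upwards [eventually_gt_atTop 0] with x hx
      have : x + 1 ≠ 0 := by positivity
      simp only [Function.comp, id]
      field_simp
    exact h.comp hM'
  have h2 : Tendsto (fun p => Real.log (2 * c) / (M p : ℝ)) l (𝓝 0) := hM'.const_div_atTop _
  have h3 : Tendsto (fun p => 3 * √((V : ℝ) * (Real.log ((M p : ℝ) + 1) / (M p : ℝ)) +
      Real.log (1 / d p) / (M p : ℝ) + Real.log (2 * c) / (M p : ℝ))) l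
      (𝓝 (3 * √((V : ℝ) * 0 + 0 + 0))) :=
    (((h1.const_mul (V : ℝ)).add hlog).add h2).sqrt.const_mul 3
  rw [mul_zero, add_zero, add_zero, Real.sqrt_zero, mul_zero] at h3
  refine h3.congr fun p => ?_
  have hlog' : Real.log (d p / c / 2) = -(Real.log (1 / d p) + Real.log (2 * c)) := by
    rw [div_div, Real.log_div (hd p).ne' (by positivity), one_div, Real.log_inv, mul_comm c 2]
    ring
  rw [vcRadius, hlog']
  congr 2
  ring

/-! ### The mixture proportion estimator -/

/-- The empirical frequencies are within the confidence radii of the mixture proportion estimator,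
uniformly over all its classes. -/
def UniformlyClose {X : Type*} [MeasurableSpace X] (𝓖 : ℕ → Set (Classifier X)) (δ : ℝ)
    (Q : Measure X) {n : ℕ} (z : Fin n → X) : Prop :=
  ∀ j, ∀ f ∈ 𝓖 j, |empFreq f 1 z - Q.real {x | f.1 x = 1}| ≤
    vcRadius (vcDim (𝓖 j)).toNat n (δ / ((j : ℝ) + 1) ^ 2)

theorem tsum_ofReal_inv_sq_ne_top :
    ∑' j : ℕ, ENNReal.ofReal (1 / ((j : ℝ) + 1) ^ 2) ≠ ⊤ := by
  refine Summable.tsum_ofReal_ne_top ?_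
  have := (summable_nat_add_iff 1).2 (Real.summable_one_div_nat_pow.2 one_lt_two)
  simpa using this

theorem level_mem {δ : ℝ} (hδ : 0 < δ) (hδ1 : δ ≤ 1) (j : ℕ) :
    0 < δ / ((j : ℝ) + 1) ^ 2 ∧ δ / ((j : ℝ) + 1) ^ 2 ≤ 1 := by
  refine ⟨by positivity, div_le_one_of_le₀ (hδ1.trans ?_) (by positivity)⟩
  exact one_le_pow₀ (by linarith [j.cast_nonneg (α := ℝ)])

/-- Union bound over the classes with levels δ/(j+1)². The total need not be at most δ: a finite
constant suffices because δ tends to 0. -/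
theorem measure_not_uniformlyClose_le {X : Type*} [MeasurableSpace X] {Q : Measure X}
    [IsProbabilityMeasure Q] {𝓖 : ℕ → Set (Classifier X)} (hV : ∀ j, vcDim (𝓖 j) ≠ ⊤)
    (hm : ∀ j, IsMeasurableClass Q (𝓖 j)) {δ : ℝ} (hδ : 0 < δ) (hδ1 : δ ≤ 1) {n : ℕ} (hn : 0 < n) :
    (Measure.pi fun _ : Fin n => Q) {z | ¬ UniformlyClose 𝓖 δ Q z} ≤
      ENNReal.ofReal δ * ∑' j : ℕ, ENNReal.ofReal (1 / ((j : ℝ) + 1) ^ 2) := by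
  have hsub : {z : Fin n → X | ¬ UniformlyClose 𝓖 δ Q z} ⊆
      ⋃ j : ℕ, {z | ∃ f ∈ 𝓖 j, vcRadius (vcDim (𝓖 j)).toNat n (δ / ((j : ℝ) + 1) ^ 2) ≤
        |empFreq f 1 z - Q.real {x | f.1 x = 1}|} := by
    intro z hz
    simp only [UniformlyClose, Set.mem_ofPred_eq, not_forall, not_le] at hz
    obtain ⟨j, f, hf, h⟩ := hz
    exact Set.mem_iUnion.2 ⟨j, f, hf, h.le⟩
  refine (measure_mono hsub).trans ((measure_iUnion_le _).trans ?_)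
  rw [← ENNReal.tsum_mul_left]
  refine ENNReal.tsum_le_tsum fun j => ?_
  obtain ⟨h0, h1⟩ := level_mem hδ hδ1 j
  refine (vc_inequality (hV j) (hm j) hn (vcRadius_pos _ hn h0 h1).le).trans ?_
  rw [← ENNReal.ofReal_mul hδ.le, mul_one_div]
  exact ENNReal.ofReal_le_ofReal (vcRadius_confidence _ hn h0 h1)

theorem le_mpe {X : Type*} [MeasurableSpace X] {F H : Measure X} {𝓖 : ℕ → Set (Classifier X)}
    {δ κ : ℝ} (hδ : 0 < δ) (hδ1 : δ ≤ 1) (hκ0 : 0 ≤ κ) (hκ1 : κ ≤ 1)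
    (hFH : ∀ f : Classifier X, κ * H.real {x | f.1 x = 1} ≤ F.real {x | f.1 x = 1})
    {m n : ℕ} (hm : 0 < m) (zF : Fin m → X) (zH : Fin n → X) (hF : UniformlyClose 𝓖 δ F zF)
    (hH : UniformlyClose 𝓖 δ H zH) : κ ≤ mpe 𝓖 δ zF zH := by
  have hne : min 1 (⨅ j : ℕ, ⨅ f ∈ 𝓖 j,
    ENNReal.ofReal (empFreq f 1 zF + vcRadius (vcDim (𝓖 j)).toNat m (δ / ((j : ℝ) + 1) ^ 2)) /
      ENNReal.ofReal
        (empFreq f 1 zH - vcRadius (vcDim (𝓖 j)).toNat n (δ / ((j : ℝ) + 1) ^ 2))) ≠ ⊤ :=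
    ne_top_of_le_ne_top ENNReal.one_ne_top (min_le_left _ _)
  refine (ENNReal.ofReal_le_iff_le_toReal hne).1 (le_min ?_ ?_)
  · exact (ENNReal.ofReal_le_ofReal hκ1).trans ENNReal.ofReal_one.le
  refine le_iInf fun j => le_iInf₂ fun f hf => ?_
  obtain ⟨h0, h1⟩ := level_mem hδ hδ1 j
  have hr := vcRadius_pos (vcDim (𝓖 j)).toNat hm h0 h1
  have hF' := (abs_le.1 (hF j f hf)).1
  have hH' := (abs_le.1 (hH j f hf)).2
  -- A positive numerator rules out `0 / 0`, which is `0` in `ENNReal`; a vanishing denominator then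
  -- gives `⊤`.
  have hpos : 0 < empFreq f 1 zF + vcRadius (vcDim (𝓖 j)).toNat m (δ / ((j : ℝ) + 1) ^ 2) :=
    add_pos_of_nonneg_of_pos (empFreq_nonneg f 1 zF) hr
  rw [ENNReal.le_div_iff_mul_le (Or.inr (ENNReal.ofReal_pos.2 hpos).ne')
    (Or.inl ENNReal.ofReal_ne_top), ← ENNReal.ofReal_mul hκ0]
  refine ENNReal.ofReal_le_ofReal ?_
  have := mul_le_mul_of_nonneg_left (show empFreq f 1 zH -
    vcRadius (vcDim (𝓖 j)).toNat n (δ / ((j : ℝ) + 1) ^ 2) ≤ H.real {x | f.1 x = 1} by linarith) hκ0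
  linarith [hFH f]

/-- One classifier bounds the infimum. The radius counts twice: once from the definition of the
ratio, once for passing from empirical to true probabilities. -/
theorem mpe_le {X : Type*} [MeasurableSpace X] {F H : Measure X} {𝓖 : ℕ → Set (Classifier X)}
    {δ : ℝ} {m n : ℕ} (zF : Fin m → X) (zH : Fin n → X) (hF : UniformlyClose 𝓖 δ F zF)
    (hH : UniformlyClose 𝓖 δ H zH) {j : ℕ} {f : Classifier X} (hf : f ∈ 𝓖 j) {a b : ℝ}
    (ha : F.real {x | f.1 x = 1} +
      2 * vcRadius (vcDim (𝓖 j)).toNat m (δ / ((j : ℝ) + 1) ^ 2) ≤ a) (ha0 : 0 ≤ a)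
    (hb : b ≤ H.real {x | f.1 x = 1} -
      2 * vcRadius (vcDim (𝓖 j)).toNat n (δ / ((j : ℝ) + 1) ^ 2)) (hb0 : 0 < b) :
    mpe 𝓖 δ zF zH ≤ a / b := by
  refine ENNReal.toReal_le_of_le_ofReal (by positivity) ?_
  refine (min_le_right _ _).trans (iInf_le_of_le j (iInf₂_le_of_le f hf ?_))
  have hF' := (abs_le.1 (hF j f hf)).2
  have hH' := (abs_le.1 (hH j f hf)).1
  rw [ENNReal.ofReal_div_of_pos hb0]
  exact ENNReal.div_le_div (ENNReal.ofReal_le_ofReal (by linarith))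
    (ENNReal.ofReal_le_ofReal (by linarith))

/-! ### Mixtures, irreducibility and approximation -/

theorem mixture_real {X : Type*} [MeasurableSpace X] {P Q : Measure X} [IsFiniteMeasure P]
    [IsFiniteMeasure Q] {π : ℝ} (h0 : 0 ≤ π) (h1 : π ≤ 1) (A : Set X) :
    (mixture π P Q).real A = (1 - π) * P.real A + π * Q.real A := by
  simp only [mixture, Measure.real, Measure.add_apply, Measure.smul_apply, smul_eq_mul]
  rw [ENNReal.toReal_add (by finiteness) (by finiteness), ENNReal.toReal_mul, ENNReal.toReal_mul,
    ENNReal.toReal_ofReal (by linarith), ENNReal.toReal_ofReal h0]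

theorem isProbabilityMeasure_mixture {X : Type*} [MeasurableSpace X] {P Q : Measure X}
    [IsProbabilityMeasure P] [IsProbabilityMeasure Q] {π : ℝ} (h0 : 0 ≤ π) (h1 : π ≤ 1) :
    IsProbabilityMeasure (mixture π P Q) := by
  refine ⟨?_⟩
  simp only [mixture, Measure.add_apply, Measure.smul_apply, smul_eq_mul, measure_univ, mul_one]
  rw [← ENNReal.ofReal_add (by linarith) h0]
  simp

/-- Otherwise `G` dominates γH for some γ > 0, and normalizing G - γH exhibits a forbidden
decomposition. -/
theorem exists_classifier_of_irreducibleWrt {X : Type*} [MeasurableSpace X] {G H : Measure X}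
    [IsProbabilityMeasure G] [IsProbabilityMeasure H] (hGH : IrreducibleWrt G H) {η : ℝ}
    (hη : 0 < η) : ∃ g : Classifier X, 0 < H.real {x | g.1 x = 1} ∧
      G.real {x | g.1 x = 1} ≤ η * H.real {x | g.1 x = 1} := by
  classical
  by_contra! hcon
  -- The cap 1/2 keeps 1 - γ positive, so that the remainder can be normalized.
  set γ := min η (1 / 2) with hγ
  have hγ0 : 0 < γ := lt_min hη (by norm_num)
  have hγ1 : γ < 1 := (min_le_right _ _).trans_lt (by norm_num)
  have hle : ENNReal.ofReal γ • H ≤ G := by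
    refine Measure.le_iff.2 fun A hA => ?_
    let g : Classifier X := ⟨fun x => if x ∈ A then 1 else 0,
      Measurable.ite hA measurable_const measurable_const⟩
    have hg : {x | g.1 x = 1} = A := by
      ext x
      by_cases hx : x ∈ A <;> simp [g, hx]
    have h := hcon g
    rw [hg] at h
    have hreal : γ * H.real A ≤ G.real A := by
      rcases (measureReal_nonneg (μ := H) (s := A)).eq_or_lt with h0 | h0
      · rw [← h0, mul_zero]; exact measureReal_nonneg
      · exact (mul_le_mul_of_nonneg_right (min_le_left _ _) h0.le).trans (h h0).le
    rw [Measure.smul_apply, smul_eq_mul, ← ofReal_measureReal, ← ofReal_measureReal,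
      ← ENNReal.ofReal_mul hγ0.le]
    exact ENNReal.ofReal_le_ofReal hreal
  have : IsFiniteMeasure (ENNReal.ofReal γ • H) := by
    refine ⟨?_⟩
    simp
  have hsub : (G - ENNReal.ofReal γ • H) + ENNReal.ofReal γ • H = G :=
    Measure.sub_add_cancel_of_le hle
  have huniv : (G - ENNReal.ofReal γ • H) Set.univ = ENNReal.ofReal (1 - γ) := by
    rw [Measure.sub_apply MeasurableSet.univ hle, Measure.smul_apply, measure_univ, measure_univ,
      smul_eq_mul, mul_one, ENNReal.ofReal_sub _ hγ0.le, ENNReal.ofReal_one]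
  have h1γ : ENNReal.ofReal (1 - γ) ≠ 0 := (ENNReal.ofReal_pos.2 (by linarith)).ne'
  refine hGH ⟨γ, (ENNReal.ofReal (1 - γ))⁻¹ • (G - ENNReal.ofReal γ • H), hγ0, hγ1.le, ⟨?_⟩, ?_⟩
  · rw [Measure.smul_apply, huniv, smul_eq_mul, ENNReal.inv_mul_cancel h1γ ENNReal.ofReal_ne_top]
  · rw [mixture, smul_smul, ENNReal.mul_inv_cancel h1γ ENNReal.ofReal_ne_top, one_smul, hsub]

/-- Approximating under the even mixture of `P` and `Q` to within s/2 controls both at once to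
within s. -/
theorem UniversalApproximation.eventually_exists {X : Type*} [MeasurableSpace X]
    {𝓕 : ℕ → Set (Classifier X)} (h : UniversalApproximation 𝓕) (P Q : Measure X)
    [IsProbabilityMeasure P] [IsProbabilityMeasure Q] (g : Classifier X) {s : ℝ} (hs : 0 < s) :
    ∀ᶠ k in atTop, ∃ f ∈ 𝓕 k, P.real {x | f.1 x ≠ g.1 x} ≤ s ∧ Q.real {x | f.1 x ≠ g.1 x} ≤ s := by
  have h0 : (0 : ℝ) ≤ 1 / 2 := by norm_num
  have h1 : (1 / 2 : ℝ) ≤ 1 := by norm_num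
  have hprob : IsProbabilityMeasure (mixture (1 / 2) P Q) := isProbabilityMeasure_mixture h0 h1
  have hlim := h (mixture (1 / 2) P Q) hprob g
  filter_upwards [hlim.eventually_lt_const (ENNReal.ofReal_pos.2 (half_pos hs))] with k hk
  simp only [iInf_lt_iff] at hk
  obtain ⟨f, hf, hlt⟩ := hk
  have hlt' : (mixture (1 / 2) P Q).real {x | f.1 x ≠ g.1 x} < s / 2 :=
    (ENNReal.lt_ofReal_iff_toReal_lt (by finiteness)).1 hlt
  rw [mixture_real h0 h1] at hlt'
  have hP := measureReal_nonneg (μ := P) (s := {x | f.1 x ≠ g.1 x})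
  have hQ := measureReal_nonneg (μ := Q) (s := {x | f.1 x ≠ g.1 x})
  exact ⟨f, hf, by linarith, by linarith⟩

theorem real_le_real_add {X : Type*} [MeasurableSpace X] (P : Measure X) [IsFiniteMeasure P]
    (f g : Classifier X) (y : Fin 2) :
    P.real {x | f.1 x = y} ≤ P.real {x | g.1 x = y} + P.real {x | f.1 x ≠ g.1 x} := by
  refine (measureReal_mono ?_).trans (measureReal_union_le _ _)
  intro x hx
  by_cases h : f.1 x = g.1 x
  · exact Or.inl (h.symm.trans hx)
  · exact Or.inr h

/-- Consistency of the mixture proportion estimator, on samples that are uniformly close to their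
distributions. -/
theorem eventually_abs_mpe_sub_le {X α : Type*} [MeasurableSpace X] {F H : Measure X}
    [IsProbabilityMeasure F] [IsProbabilityMeasure H] {𝓖 : ℕ → Set (Classifier X)}
    (h𝓖 : UniversalApproximation 𝓖) {κ : ℝ} (hκ0 : 0 ≤ κ) (hκ1 : κ ≤ 1)
    (hFH : ∀ f : Classifier X, κ * H.real {x | f.1 x = 1} ≤ F.real {x | f.1 x = 1})
    (hsep : ∀ η : ℝ, 0 < η → ∃ g : Classifier X, 0 < H.real {x | g.1 x = 1} ∧
      F.real {x | g.1 x = 1} ≤ (κ + η) * H.real {x | g.1 x = 1})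
    {l : Filter α} {M N : α → ℕ} {d : α → ℝ} (hM : Tendsto M l atTop) (hN : Tendsto N l atTop)
    (hd : ∀ p, 0 < d p ∧ d p ≤ 1)
    (hMlog : Tendsto (fun p => Real.log (1 / d p) / (M p : ℝ)) l (𝓝 0))
    (hNlog : Tendsto (fun p => Real.log (1 / d p) / (N p : ℝ)) l (𝓝 0)) {η : ℝ} (hη : 0 < η) :
    ∀ᶠ p in l, ∀ (zF : Fin (M p) → X) (zH : Fin (N p) → X), UniformlyClose 𝓖 (d p) F zF →
      UniformlyClose 𝓖 (d p) H zH → |mpe 𝓖 (d p) zF zH - κ| ≤ η := by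
  obtain ⟨g, hg0, hg⟩ := hsep (η / 4) (by linarith)
  set h := H.real {x | g.1 x = 1}
  -- With this error s, moving from `g` to `f` costs at most s(1+κ+η) ≤ s(2+η) = ηh/4, below the
  -- available margin 3ηh/4.
  obtain ⟨j, f, hf, hfF, hfH⟩ := (h𝓖.eventually_exists F H g
    (s := η * h / (4 * (2 + η))) (by positivity)).exists
  set s := η * h / (4 * (2 + η)) with hs
  have hs' : s * (2 + η) = η * h / 4 := by rw [hs]; field_simp
  have hs0 : 0 < s := by positivity
  have hFf := real_le_real_add F f g 1
  have hHf := real_le_real_add H g f 1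
  have hsymm : {x | g.1 x ≠ f.1 x} = {x | f.1 x ≠ g.1 x} := by ext x; exact ne_comm
  rw [hsymm] at hHf
  set a := F.real {x | f.1 x = 1}
  set b := H.real {x | f.1 x = 1}
  have ha0 : 0 ≤ a := measureReal_nonneg
  have hb0 : 0 < b := by
    have : s < h := by nlinarith
    have hh : h ≤ b + s := hHf.trans (by linarith)
    linarith
  have hab : a / b < κ + η := by
    rw [div_lt_iff₀ hb0]
    have h1 : a ≤ (κ + η / 4) * h + s := by linarith
    have h2 : (κ + η) * (h - s) ≤ (κ + η) * b :=
      mul_le_mul_of_nonneg_left (by linarith) (by linarith)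
    nlinarith [mul_nonneg hκ0 hs0.le, mul_le_mul_of_nonneg_right hκ1 hs0.le]
  have hrM := tendsto_vcRadius hM (fun p => (hd p).1) hMlog (vcDim (𝓖 j)).toNat
    (show 0 < ((j : ℝ) + 1) ^ 2 by positivity)
  have hrN := tendsto_vcRadius hN (fun p => (hd p).1) hNlog (vcDim (𝓖 j)).toNat
    (show 0 < ((j : ℝ) + 1) ^ 2 by positivity)
  have hnum := (hrM.const_mul 2).const_add a
  have hden := (hrN.const_mul 2).const_sub b
  rw [mul_zero, add_zero] at hnum
  rw [mul_zero, sub_zero] at hden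
  filter_upwards [(hnum.div hden hb0.ne').eventually_lt_const hab, hden.eventually_const_lt hb0,
    hM.eventually_gt_atTop 0] with p hp hpden hpM zF zH hF hH
  have hlow := le_mpe (hd p).1 (hd p).2 hκ0 hκ1 hFH hpM zF zH hF hH
  obtain ⟨l0, l1⟩ := level_mem (hd p).1 (hd p).2 j
  have hr := vcRadius_pos (vcDim (𝓖 j)).toNat hpM l0 l1
  have hup := mpe_le zF zH hF hH hf le_rfl (by linarith) le_rfl hpden
  rw [abs_le]
  constructor
  · linarith
  · have := hup.trans hp.le
    linarith

/-! ### The contaminated distributions -/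

theorem real_label_zero {X : Type*} [MeasurableSpace X] (P : Measure X) [IsProbabilityMeasure P]
    (f : Classifier X) : P.real {x | f.1 x = 0} = 1 - P.real {x | f.1 x = 1} := by
  have hS : MeasurableSet {x : X | f.1 x = 1} := f.2 (measurableSet_singleton 1)
  rw [← probReal_compl_eq_one_sub hS]
  congr 1
  ext x
  simp only [Set.mem_ofPred_eq, Set.mem_compl_iff]
  omega

theorem empFreq_zero_label {X : Type*} [MeasurableSpace X] {n : ℕ} (hn : 0 < n) (f : Classifier X)
    (z : Fin n → X) : empFreq f 0 z = 1 - empFreq f 1 z := by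
  have hn' : (n : ℝ) ≠ 0 := by positivity
  have h : ∑ i, (if f.1 (z i) = 0 then (1 : ℝ) else 0) +
      ∑ i, (if f.1 (z i) = 1 then (1 : ℝ) else 0) = n := by
    rw [← Finset.sum_add_distrib]
    calc _ = ∑ _i : Fin n, (1 : ℝ) := Finset.sum_congr rfl fun i _ => by
          rcases Fin.exists_fin_two.1 ⟨f.1 (z i), rfl⟩ with h | h <;> simp [h]
      _ = n := by simp
  unfold empFreq
  rw [← eq_sub_iff_add_eq] at h
  rw [h]
  field_simp

theorem real_mixture_eq {X : Type*} [MeasurableSpace X] {P Q : Measure X}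
    [IsProbabilityMeasure P] [IsProbabilityMeasure Q] {a b : ℝ} (ha : 0 ≤ a) (hb : 0 ≤ b)
    (hab : a + b < 1) (A : Set X) :
    (mixture a P Q).real A = (1 - a / (1 - b)) * P.real A + a / (1 - b) * (mixture b Q P).real A := by
  rw [mixture_real ha (by linarith), mixture_real hb (by linarith)]
  have : (1 : ℝ) - b ≠ 0 := by linarith
  field_simp
  ring

/-- This shows that a/(1-b) is the largest possible proportion. The tolerance η(1-b) is used for the
pure distributions because the mixture around `Q` has at least 1-b times the mass of `Q`. -/
theorem exists_classifier_mixture {X : Type*} [MeasurableSpace X] {P Q : Measure X}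
    [IsProbabilityMeasure P] [IsProbabilityMeasure Q] (hPQ : IrreducibleWrt P Q) {a b : ℝ}
    (ha : 0 ≤ a) (hb : 0 ≤ b) (hab : a + b < 1) {η : ℝ} (hη : 0 < η) :
    ∃ g : Classifier X, 0 < (mixture b Q P).real {x | g.1 x = 1} ∧
      (mixture a P Q).real {x | g.1 x = 1} ≤
        (a / (1 - b) + η) * (mixture b Q P).real {x | g.1 x = 1} := by
  have hb1 : 0 < 1 - b := by linarith
  obtain ⟨g, hg0, hg⟩ := exists_classifier_of_irreducibleWrt hPQ (mul_pos hη hb1)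
  have hH := mixture_real (P := Q) (Q := P) hb (by linarith) {x | g.1 x = 1}
  have hP : 0 ≤ P.real {x | g.1 x = 1} := measureReal_nonneg
  have h1 : 0 < (1 - b) * Q.real {x | g.1 x = 1} := mul_pos hb1 hg0
  have h2 : 0 ≤ b * P.real {x | g.1 x = 1} := mul_nonneg hb hP
  refine ⟨g, by linarith, ?_⟩
  rw [real_mixture_eq ha hb hab]
  have h3 : η * ((1 - b) * Q.real {x | g.1 x = 1}) ≤ η * (mixture b Q P).real {x | g.1 x = 1} :=
    mul_le_mul_of_nonneg_left (by linarith) hη.le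
  have h4 : 0 ≤ a / (1 - b) * P.real {x | g.1 x = 1} := mul_nonneg (div_nonneg ha hb1.le) hP
  nlinarith

/-- The error of a classifier under `P` in terms of its errors under the contaminated
distributions. -/
theorem real_eq_of_mixture {X : Type*} [MeasurableSpace X] {P Q : Measure X}
    [IsProbabilityMeasure P] [IsProbabilityMeasure Q] {a b : ℝ} (ha : 0 ≤ a) (hb : 0 ≤ b)
    (hab : a + b < 1) {A B : Set X} (hA : MeasurableSet A) (hB : B = Aᶜ) :
    P.real A = 1 - (mixture b Q P).real B -
      (1 - (mixture a P Q).real A - (mixture b Q P).real B) / (1 - a / (1 - b)) := by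
  rw [mixture_real ha (by linarith), mixture_real hb (by linarith), hB,
    probReal_compl_eq_one_sub hA, probReal_compl_eq_one_sub hA]
  have h1 : (1 : ℝ) - b ≠ 0 := by linarith
  have h2 : (1 : ℝ) - b - a ≠ 0 := by linarith
  have h3 : 1 - a / (1 - b) = (1 - b - a) / (1 - b) := by field_simp
  rw [h3]
  field_simp
  ring

/-- Continuity of the plug-in estimate of an error. -/
theorem abs_plugin_sub_le {r s t u p κ α β : ℝ} (hκ0 : 0 ≤ κ) (hκ1 : κ < 1)
    (ht : 0 ≤ t ∧ t ≤ 1) (hu : 0 ≤ u ∧ u ≤ 1)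
    (hα : α ≤ (1 - κ) / 2) (hαβ : 7 * α ≤ β * (1 - κ) ^ 2) (hr : |r - t| ≤ α) (hs : |s - u| ≤ α)
    (hp : |p - κ| ≤ α) :
    |(1 - s - (1 - r - s) / (1 - p)) - (1 - u - (1 - t - u) / (1 - κ))| ≤ β := by
  set c := 1 - κ with hc
  set d := 1 - p with hd
  have hc0 : 0 < c := by linarith
  have hdc : |c - d| ≤ α := by rw [hc, hd]; convert hp using 2; ring
  have hd0 : c / 2 ≤ d := by linarith [(abs_le.1 hdc).2]
  have hd0' : 0 < d := by linarith
  have hα0 : 0 ≤ α := (abs_nonneg _).trans hr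
  have hid : (1 - s - (1 - r - s) / d) - (1 - u - (1 - t - u) / c) =
      (u - s) + ((1 - t - u) * (d - c) + c * ((r - t) + (s - u))) / (c * d) := by
    field_simp
    ring
  have hnum : |(1 - t - u) * (d - c) + c * ((r - t) + (s - u))| ≤ 3 * α := by
    have h1 : |(1 - t - u) * (d - c)| ≤ 1 * α := by
      rw [abs_mul, abs_sub_comm d c]
      exact mul_le_mul (abs_le.2 ⟨by linarith, by linarith⟩) hdc (abs_nonneg _) zero_le_one
    have h2 : |c * ((r - t) + (s - u))| ≤ 1 * (α + α) := by
      rw [abs_mul]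
      refine mul_le_mul (abs_le.2 ⟨by linarith, by linarith⟩)
        ((abs_add_le _ _).trans (add_le_add hr hs)) (abs_nonneg _) zero_le_one
    exact (abs_add_le _ _).trans (by linarith)
  have hden : c ^ 2 / 2 ≤ c * d := by nlinarith
  have hquot : |((1 - t - u) * (d - c) + c * ((r - t) + (s - u))) / (c * d)| ≤
      3 * α / (c ^ 2 / 2) := by
    rw [abs_div, abs_of_pos (mul_pos hc0 hd0')]
    exact div_le_div₀ (by positivity) hnum (by positivity) hden
  -- As c ≤ 1, the left side is at most 7α/c², whence the constant 7 in the hypothesis.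
  have hfin : α + 3 * α / (c ^ 2 / 2) ≤ β := by
    have hc2 : c ^ 2 ≤ 1 := by nlinarith
    have : α + 3 * α / (c ^ 2 / 2) = (α * c ^ 2 + 6 * α) / c ^ 2 := by field_simp; ring
    rw [this, div_le_iff₀ (by positivity)]
    nlinarith
  rw [hid]
  refine (abs_add_le _ _).trans (le_trans (add_le_add ?_ hquot) hfin)
  rwa [abs_sub_comm]

theorem abs_max_sub_max_le {a b c d β : ℝ} (h1 : |a - c| ≤ β) (h2 : |b - d| ≤ β) :
    |max a b - max c d| ≤ β :=
  (abs_max_sub_max_le_max a b c d).trans (max_le h1 h2)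

theorem abs_estMaxError_sub_le {X : Type*} [MeasurableSpace X] {P₀ P₁ : Measure X}
    [IsProbabilityMeasure P₀] [IsProbabilityMeasure P₁] {π₀ π₁ : ℝ} (hπ₀ : 0 ≤ π₀) (hπ₁ : 0 ≤ π₁)
    (hA : π₀ + π₁ < 1) {α β p₀ p₁ : ℝ} {m n : ℕ} (hn : 0 < n)
    {z₀ : Fin m → X} {z₁ : Fin n → X} {f : Classifier X}
    (hα₀ : α ≤ (1 - π₀ / (1 - π₁)) / 2) (hα₁ : α ≤ (1 - π₁ / (1 - π₀)) / 2)
    (hβ₀ : 7 * α ≤ β * (1 - π₀ / (1 - π₁)) ^ 2) (hβ₁ : 7 * α ≤ β * (1 - π₁ / (1 - π₀)) ^ 2)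
    (hp₀ : |p₀ - π₀ / (1 - π₁)| ≤ α) (hp₁ : |p₁ - π₁ / (1 - π₀)| ≤ α)
    (h₀ : |empFreq f 1 z₀ - (mixture π₀ P₀ P₁).real {x | f.1 x = 1}| ≤ α)
    (h₁ : |empFreq f 1 z₁ - (mixture π₁ P₁ P₀).real {x | f.1 x = 1}| ≤ α) :
    |estMaxError p₀ p₁ z₀ z₁ f - maxError P₀ P₁ f| ≤ β := by
  have hprob₀ : IsProbabilityMeasure (mixture π₀ P₀ P₁) :=
    isProbabilityMeasure_mixture hπ₀ (by linarith)
  have hprob₁ : IsProbabilityMeasure (mixture π₁ P₁ P₀) :=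
    isProbabilityMeasure_mixture hπ₁ (by linarith)
  have hκ₀ : π₀ / (1 - π₁) < 1 := (div_lt_one (by linarith)).2 (by linarith)
  have hκ₁ : π₁ / (1 - π₀) < 1 := (div_lt_one (by linarith)).2 (by linarith)
  have hκ₀' : 0 ≤ π₀ / (1 - π₁) := div_nonneg hπ₀ (by linarith)
  have hκ₁' : 0 ≤ π₁ / (1 - π₀) := div_nonneg hπ₁ (by linarith)
  have h₁' : |empFreq f 0 z₁ - (mixture π₁ P₁ P₀).real {x | f.1 x = 0}| ≤ α := by
    rw [empFreq_zero_label hn, real_label_zero, abs_sub_comm]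
    convert h₁ using 2
    ring
  have hcompl : {x | f.1 x = 0} = {x | f.1 x = 1}ᶜ := by
    ext x
    simp only [Set.mem_ofPred_eq, Set.mem_compl_iff]
    omega
  have hcompl' : {x | f.1 x = 1} = {x | f.1 x = 0}ᶜ := by rw [hcompl, compl_compl]
  have e₀ : typeIError P₀ f = _ := real_eq_of_mixture (P := P₀) (Q := P₁) hπ₀ hπ₁ hA
    (f.2 (measurableSet_singleton 1) : MeasurableSet {x | f.1 x = 1}) hcompl
  have e₁ : typeIIError P₁ f = _ := real_eq_of_mixture (P := P₁) (Q := P₀) hπ₁ hπ₀ (by linarith)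
    (f.2 (measurableSet_singleton 0) : MeasurableSet {x | f.1 x = 0}) hcompl'
  refine abs_max_sub_max_le ?_ ?_
  · rw [e₀, estTypeIError]
    exact abs_plugin_sub_le hκ₀' hκ₀ ⟨measureReal_nonneg, measureReal_le_one⟩
      ⟨measureReal_nonneg, measureReal_le_one⟩ hα₀ hβ₀ h₀ h₁' hp₀
  · rw [e₁, estTypeIIError]
    exact abs_plugin_sub_le hκ₁' hκ₁ ⟨measureReal_nonneg, measureReal_le_one⟩
      ⟨measureReal_nonneg, measureReal_le_one⟩ hα₁ hβ₁ h₁' h₀ hp₁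

/-! ### The max error -/

theorem minmaxError_le {X : Type*} [MeasurableSpace X] (P₀ P₁ : Measure X) (f : Classifier X) :
    minmaxError P₀ P₁ ≤ maxError P₀ P₁ f := by
  refine ciInf_le ⟨0, ?_⟩ f
  rintro _ ⟨g, rfl⟩
  exact le_max_of_le_left measureReal_nonneg

theorem exists_maxError_lt {X : Type*} [MeasurableSpace X] (P₀ P₁ : Measure X) {β : ℝ}
    (hβ : 0 < β) : ∃ g : Classifier X, maxError P₀ P₁ g < minmaxError P₀ P₁ + β := by
  have : Nonempty (Classifier X) := ⟨⟨fun _ => 0, measurable_const⟩⟩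
  exact exists_lt_of_ciInf_lt (lt_add_of_pos_right _ hβ)

theorem maxError_le_add {X : Type*} [MeasurableSpace X] {P₀ P₁ : Measure X}
    [IsFiniteMeasure P₀] [IsFiniteMeasure P₁] {f g : Classifier X} {s : ℝ}
    (h₀ : P₀.real {x | f.1 x ≠ g.1 x} ≤ s) (h₁ : P₁.real {x | f.1 x ≠ g.1 x} ≤ s) :
    maxError P₀ P₁ f ≤ maxError P₀ P₁ g + s := by
  refine max_le ?_ ?_
  · have h : P₀.real {x | g.1 x = 1} ≤ maxError P₀ P₁ g := le_max_left _ _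
    exact (real_le_real_add P₀ f g 1).trans (add_le_add h h₀)
  · have h : P₁.real {x | g.1 x = 0} ≤ maxError P₀ P₁ g := le_max_right _ _
    exact (real_le_real_add P₁ f g 0).trans (add_le_add h h₁)

/-- An approximate minimizer of an estimate that is uniformly accurate over a class has almost
the least error over that class. -/
theorem maxError_le_of_mem_approxMinimizers {X : Type*} [MeasurableSpace X] {P₀ P₁ : Measure X}
    {𝓕 : Set (Classifier X)} {τ p₀ p₁ β : ℝ} {m n : ℕ} {z₀ : Fin m → X} {z₁ : Fin n → X}
    (hest : ∀ f ∈ 𝓕, |estMaxError p₀ p₁ z₀ z₁ f - maxError P₀ P₁ f| ≤ β) {f g : Classifier X}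
    (hf : f ∈ approxMinimizers 𝓕 τ p₀ p₁ z₀ z₁) (hg : g ∈ 𝓕) :
    maxError P₀ P₁ f ≤ maxError P₀ P₁ g + τ + 2 * β := by
  -- Estimated errors can be negative; a lower bound is needed for the real `sInf` to be a genuine
  -- infimum.
  have hbdd : BddBelow (estMaxError p₀ p₁ z₀ z₁ '' 𝓕) := by
    refine ⟨-β, ?_⟩
    rintro _ ⟨h, hh, rfl⟩
    have h0 : 0 ≤ maxError P₀ P₁ h := le_max_of_le_left measureReal_nonneg
    linarith [(abs_le.1 (hest h hh)).1]
  have h1 := csInf_le hbdd (Set.mem_image_of_mem _ hg)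
  linarith [hf.2, (abs_le.1 (hest f hf.1)).1, (abs_le.1 (hest g hg)).2]

/-! ### The limiting regime -/

theorem tendsto_min_minAtTop :
    Tendsto (fun p : ℕ × ℕ => min p.1 p.2) minAtTop atTop := tendsto_comap

theorem tendsto_fst_minAtTop : Tendsto (fun p : ℕ × ℕ => p.1) minAtTop atTop :=
  tendsto_atTop_mono (fun _ => min_le_left _ _) tendsto_min_minAtTop

theorem tendsto_snd_minAtTop : Tendsto (fun p : ℕ × ℕ => p.2) minAtTop atTop :=
  tendsto_atTop_mono (fun _ => min_le_right _ _) tendsto_min_minAtTop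

theorem tendsto_swap_minAtTop : Tendsto (Prod.swap : ℕ × ℕ → ℕ × ℕ) minAtTop minAtTop := by
  refine tendsto_comap_iff.2 (tendsto_min_minAtTop.congr fun p => ?_)
  exact min_comm _ _

theorem tendsto_div_of_le {α : Type*} {l : Filter α} {g : α → ℝ} {N M : α → ℕ}
    (hg : ∀ p, 0 ≤ g p) (hN : Tendsto N l atTop) (hNM : ∀ p, N p ≤ M p)
    (h : Tendsto (fun p => g p / (N p : ℝ)) l (𝓝 0)) :
    Tendsto (fun p => g p / (M p : ℝ)) l (𝓝 0) := by
  refine squeeze_zero' (Eventually.of_forall fun p => div_nonneg (hg p) (Nat.cast_nonneg _)) ?_ h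
  filter_upwards [hN.eventually_gt_atTop 0] with p hp
  exact div_le_div_of_nonneg_left (hg p) (by exact_mod_cast hp) (by exact_mod_cast hNM p)

/-- The bound of the Vapnik–Chervonenkis inequality vanishes if `V log N / N → 0` for a lower
bound `N → ∞` of the sample sizes. -/
theorem tendsto_vc_bound {α : Type*} {l : Filter α} {V N M : α → ℕ} (hN : Tendsto N l atTop)
    (hNM : ∀ p, N p ≤ M p)
    (h : Tendsto (fun p => (V p : ℝ) * Real.log (N p : ℝ) / (N p : ℝ)) l (𝓝 0)) {ε : ℝ}
    (hε : 0 < ε) :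
    Tendsto (fun p => 2 * (2 * (M p : ℝ) + 1) ^ V p * Real.exp (-(M p * ε ^ 2 / 2))) l (𝓝 0) := by
  have hM : Tendsto (fun p => (M p : ℝ)) l atTop :=
    tendsto_natCast_atTop_atTop.comp (tendsto_atTop_mono hNM hN)
  have hlim : Tendsto (fun p => 2 * Real.exp (-(M p * (ε ^ 2 / 4)))) l (𝓝 0) := by
    have h1 : Tendsto (fun p => (M p : ℝ) * (ε ^ 2 / 4)) l atTop :=
      hM.atTop_mul_const (by positivity)
    have h2 := (Real.tendsto_exp_neg_atTop_nhds_zero.comp h1).const_mul 2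
    rw [mul_zero] at h2
    exact h2
  refine squeeze_zero' (Eventually.of_forall fun p => by positivity) ?_ hlim
  -- From 3 on, log x / x decreases (3 > e), which carries the rate from `N` to `M`, and 2M+1 ≤ M².
  -- Then (2M+1)^V ≤ exp(Mε²/4), half of the exponent.
  filter_upwards [hN.eventually_ge_atTop 3,
    h.eventually_lt_const (show 0 < ε ^ 2 / 8 by positivity)] with p hp3 hp
  have hN3 : (3 : ℝ) ≤ N p := by exact_mod_cast hp3
  have hMN : (N p : ℝ) ≤ M p := by exact_mod_cast hNM p
  have hM0 : (0 : ℝ) < M p := by linarith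
  have hanti : Real.log (M p) / M p ≤ Real.log (N p) / N p :=
    Real.log_div_self_antitoneOn (Set.mem_Ici.2 (by linarith [Real.exp_one_lt_three]))
      (Set.mem_Ici.2 (by linarith [Real.exp_one_lt_three])) hMN
  have hV : (V p : ℝ) * Real.log (M p) ≤ ε ^ 2 / 8 * M p := by
    have h1 := mul_le_mul_of_nonneg_left hanti (V p).cast_nonneg (α := ℝ)
    rw [← mul_div_assoc, ← mul_div_assoc] at h1
    exact (div_le_iff₀ hM0).1 (h1.trans hp.le)
  have hpow : (2 * (M p : ℝ) + 1) ^ V p ≤ Real.exp (2 * (V p * Real.log (M p))) := by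
    have : Real.exp (2 * (V p * Real.log (M p))) = ((M p : ℝ) ^ 2) ^ V p := by
      conv_rhs => rw [← Real.exp_log hM0, ← Real.exp_nat_mul, ← Real.exp_nat_mul]
      congr 1
      push_cast
      ring
    rw [this]
    exact pow_le_pow_left₀ (by linarith) (by nlinarith) _
  calc 2 * (2 * (M p : ℝ) + 1) ^ V p * Real.exp (-(M p * ε ^ 2 / 2))
      ≤ 2 * Real.exp (2 * (V p * Real.log (M p))) * Real.exp (-(M p * ε ^ 2 / 2)) := by gcongr
    _ = 2 * Real.exp (2 * (V p * Real.log (M p)) - M p * ε ^ 2 / 2) := by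
        rw [mul_assoc, ← Real.exp_add, sub_eq_add_neg]
    _ ≤ _ := mul_le_mul_of_nonneg_left (Real.exp_le_exp.2 (by linarith)) (by norm_num)

/-- The outer probability of a sample on which one of the uniform approximations fails. -/
theorem measure_not_close_le {X : Type*} [MeasurableSpace X] {Q : Measure X}
    [IsProbabilityMeasure Q] {𝓖 : ℕ → Set (Classifier X)} (h𝓖_vc : ∀ j, vcDim (𝓖 j) ≠ ⊤)
    (h𝓖_meas : ∀ j, IsMeasurableClass Q (𝓖 j)) {𝓕 : Set (Classifier X)} (h𝓕_vc : vcDim 𝓕 ≠ ⊤)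
    (h𝓕_meas : IsMeasurableClass Q 𝓕) {d d' α : ℝ} (hd : 0 < d ∧ d ≤ 1) (hd' : 0 < d' ∧ d' ≤ 1)
    (hα : 0 ≤ α) {n : ℕ} (hn : 0 < n) :
    (Measure.pi fun _ : Fin n => Q) {z | ¬ (UniformlyClose 𝓖 d Q z ∧ UniformlyClose 𝓖 d' Q z ∧
        ∀ f ∈ 𝓕, |empFreq f 1 z - Q.real {x | f.1 x = 1}| ≤ α)} ≤
      ENNReal.ofReal d * ∑' j : ℕ, ENNReal.ofReal (1 / ((j : ℝ) + 1) ^ 2) +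
        ENNReal.ofReal d' * ∑' j : ℕ, ENNReal.ofReal (1 / ((j : ℝ) + 1) ^ 2) +
        ENNReal.ofReal (2 * (2 * (n : ℝ) + 1) ^ (vcDim 𝓕).toNat * Real.exp (-(n * α ^ 2 / 2))) := by
  have hsub : {z : Fin n → X | ¬ (UniformlyClose 𝓖 d Q z ∧ UniformlyClose 𝓖 d' Q z ∧
        ∀ f ∈ 𝓕, |empFreq f 1 z - Q.real {x | f.1 x = 1}| ≤ α)} ⊆
      ({z | ¬ UniformlyClose 𝓖 d Q z} ∪ {z | ¬ UniformlyClose 𝓖 d' Q z}) ∪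
        {z | ∃ f ∈ 𝓕, α ≤ |empFreq f 1 z - Q.real {x | f.1 x = 1}|} := by
    intro z hz
    by_contra hcon
    simp only [Set.mem_union, Set.mem_ofPred_eq, not_or, not_not, not_exists, not_and, not_le]
      at hcon
    exact hz ⟨hcon.1.1, hcon.1.2, fun f hf => (hcon.2 f hf).le⟩
  refine (measure_mono hsub).trans ((measure_union_le _ _).trans (add_le_add
    ((measure_union_le _ _).trans (add_le_add ?_ ?_)) ?_))
  · exact measure_not_uniformlyClose_le h𝓖_vc h𝓖_meas hd.1 hd.2 hn
  · exact measure_not_uniformlyClose_le h𝓖_vc h𝓖_meas hd'.1 hd'.2 hn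
  · exact vc_inequality h𝓕_vc h𝓕_meas hn hα

/-- The product formula for rectangles holds for arbitrary sides, so the union bound applies to
outer probabilities. -/
theorem measure_prod_le_add {Ω Ω' : Type*} [MeasurableSpace Ω] [MeasurableSpace Ω']
    {μ : Measure Ω} {ν : Measure Ω'} [IsProbabilityMeasure μ] [IsProbabilityMeasure ν]
    {S : Set (Ω × Ω')} {A : Set Ω} {B : Set Ω'} (hS : ∀ z ∈ S, z.1 ∈ A ∨ z.2 ∈ B) :
    (μ.prod ν) S ≤ μ A + ν B := by
  have hsub : S ⊆ A ×ˢ Set.univ ∪ Set.univ ×ˢ B := fun z hz => by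
    rcases hS z hz with h | h
    · exact Or.inl ⟨h, trivial⟩
    · exact Or.inr ⟨trivial, h⟩
  refine (measure_mono hsub).trans ((measure_union_le _ _).trans (le_of_eq ?_))
  rw [Measure.prod_prod, Measure.prod_prod, measure_univ, measure_univ, mul_one, one_mul]

theorem tendsto_failure_bound {α : Type*} {l : Filter α} {d d' : α → ℝ} {V N M : α → ℕ}
    (hd : Tendsto d l (𝓝 0)) (hd' : Tendsto d' l (𝓝 0)) (hN : Tendsto N l atTop)
    (hNM : ∀ p, N p ≤ M p)
    (h : Tendsto (fun p => (V p : ℝ) * Real.log (N p : ℝ) / (N p : ℝ)) l (𝓝 0)) {ε : ℝ}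
    (hε : 0 < ε) :
    Tendsto (fun p => ENNReal.ofReal (d p) * ∑' j : ℕ, ENNReal.ofReal (1 / ((j : ℝ) + 1) ^ 2) +
        ENNReal.ofReal (d' p) * ∑' j : ℕ, ENNReal.ofReal (1 / ((j : ℝ) + 1) ^ 2) +
        ENNReal.ofReal (2 * (2 * (M p : ℝ) + 1) ^ V p * Real.exp (-(M p * ε ^ 2 / 2)))) l (𝓝 0) := by
  have hC : ∀ {u : α → ℝ}, Tendsto u l (𝓝 0) → Tendsto (fun p => ENNReal.ofReal (u p) *
      ∑' j : ℕ, ENNReal.ofReal (1 / ((j : ℝ) + 1) ^ 2)) l (𝓝 0) := by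
    intro u hu
    have h1 := ENNReal.tendsto_ofReal hu
    rw [ENNReal.ofReal_zero] at h1
    have h2 := ENNReal.Tendsto.mul_const h1 (Or.inr tsum_ofReal_inv_sq_ne_top)
    rwa [zero_mul] at h2
  have hvc := ENNReal.tendsto_ofReal (tendsto_vc_bound hN hNM h hε)
  rw [ENNReal.ofReal_zero] at hvc
  have := ((hC hd).add (hC hd')).add hvc
  rwa [add_zero, add_zero] at this

end LabelNoise

/-! ### Convergence of the max error to the minmax error -/

theorem mainTheorem1 {X : Type*} [MeasurableSpace X]
    -- the true class-conditional distributions and the contamination proportions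
    (P₀ P₁ : Measure X) [IsProbabilityMeasure P₀] [IsProbabilityMeasure P₁]
    (π₀ π₁ : ℝ) (hπ₀ : 0 ≤ π₀) (hπ₁ : 0 ≤ π₁)
    -- the contaminated distributions
    (Pt₀ Pt₁ : Measure X)
    (hPt₀ : Pt₀ = LabelNoise.mixture π₀ P₀ P₁) (hPt₁ : Pt₁ = LabelNoise.mixture π₁ P₁ P₀)
    -- (A) and (C)
    (hA : π₀ + π₁ < 1)
    (hC : LabelNoise.MutuallyIrreducible P₀ P₁)
    -- the classes over which the estimated error is minimized, with (D)
    (𝓕 : ℕ → Set (LabelNoise.Classifier X))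
    (h𝓕_vc : ∀ k, LabelNoise.vcDim (𝓕 k) ≠ ⊤)
    (h𝓕_meas : ∀ k, LabelNoise.IsMeasurableClass Pt₀ (𝓕 k) ∧ LabelNoise.IsMeasurableClass Pt₁ (𝓕 k))
    (hD : LabelNoise.UniversalApproximation 𝓕)
    -- the classes and the levels on which the mixture proportion estimator is built
    (𝓖 : ℕ → Set (LabelNoise.Classifier X))
    (h𝓖_vc : ∀ j, LabelNoise.vcDim (𝓖 j) ≠ ⊤)
    (h𝓖_meas : ∀ j, LabelNoise.IsMeasurableClass Pt₀ (𝓖 j) ∧ LabelNoise.IsMeasurableClass Pt₁ (𝓖 j))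
    (h𝓖_approx : LabelNoise.UniversalApproximation 𝓖)
    (δ : ℕ → ℕ → ℝ) (hδ : ∀ m n, 0 < δ m n ∧ δ m n ≤ 1)
    (hδ_zero : Tendsto (fun p : ℕ × ℕ => δ p.1 p.2) LabelNoise.minAtTop (𝓝 0))
    (hδ_log : Tendsto (fun p : ℕ × ℕ => Real.log (1 / δ p.1 p.2) / ((min p.1 p.2 : ℕ) : ℝ))
      LabelNoise.minAtTop (𝓝 0))
    -- the choice of the class index
    (k : ℕ → ℕ → ℕ)
    (hk : Tendsto (fun p : ℕ × ℕ => k p.1 p.2) LabelNoise.minAtTop atTop)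
    (hkV : Tendsto (fun p : ℕ × ℕ => ((LabelNoise.vcDim (𝓕 (k p.1 p.2))).toNat : ℝ) *
        Real.log ((min p.1 p.2 : ℕ) : ℝ) / ((min p.1 p.2 : ℕ) : ℝ))
      LabelNoise.minAtTop (𝓝 0))
    -- the tolerance
    (τ : ℕ → ℝ) (hτ_pos : ∀ i, 0 < τ i) (hτ : Tendsto τ atTop (𝓝 0))
    -- the discrimination rule: an approximate minimizer of the estimated max error; nothing is
    -- required on samples where an estimated proportion equals 1 (the estimated errors, which have
    -- 1 minus that proportion as a denominator, are then undefined)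
    (fhat : ∀ m n : ℕ, (Fin m → X) → (Fin n → X) → LabelNoise.Classifier X)
    (hfhat : ∀ m n : ℕ, 0 < m → 0 < n → ∀ (z₀ : Fin m → X) (z₁ : Fin n → X),
      LabelNoise.mpe 𝓖 (δ m n) z₀ z₁ < 1 → LabelNoise.mpe 𝓖 (δ n m) z₁ z₀ < 1 →
      fhat m n z₀ z₁ ∈ LabelNoise.approxMinimizers (𝓕 (k m n)) (τ (k m n))
        (LabelNoise.mpe 𝓖 (δ m n) z₀ z₁) (LabelNoise.mpe 𝓖 (δ n m) z₁ z₀) z₀ z₁) :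
    -- convergence in probability of the max error to the minmax error
    ∀ ε : ℝ, 0 < ε →
      Tendsto (fun p : ℕ × ℕ =>
        ((Measure.pi fun _ : Fin p.1 => Pt₀).prod (Measure.pi fun _ : Fin p.2 => Pt₁))
          {z | ε ≤ |LabelNoise.maxError P₀ P₁ (fhat p.1 p.2 z.1 z.2) -
            LabelNoise.minmaxError P₀ P₁|})
        LabelNoise.minAtTop (𝓝 0) := by
  intro ε hε
  subst hPt₀ hPt₁
  have hprob₀ : IsProbabilityMeasure (LabelNoise.mixture π₀ P₀ P₁) :=
    LabelNoise.isProbabilityMeasure_mixture hπ₀ (by linarith)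
  have hprob₁ : IsProbabilityMeasure (LabelNoise.mixture π₁ P₁ P₀) :=
    LabelNoise.isProbabilityMeasure_mixture hπ₁ (by linarith)
  have hA' : π₁ + π₀ < 1 := by linarith
  have hκ₀ : π₀ / (1 - π₁) < 1 := (div_lt_one (by linarith)).2 (by linarith)
  have hκ₁ : π₁ / (1 - π₀) < 1 := (div_lt_one (by linarith)).2 (by linarith)
  have hκ₀' : 0 ≤ π₀ / (1 - π₁) := div_nonneg hπ₀ (by linarith)
  have hκ₁' : 0 ≤ π₁ / (1 - π₀) := div_nonneg hπ₁ (by linarith)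
  -- the accuracies
  set β := ε / 8 with hβ
  have hβ0 : 0 < β := by positivity
  obtain ⟨α, hα0, hα₀, hα₁, hβ₀, hβ₁⟩ : ∃ α : ℝ, 0 < α ∧ α ≤ (1 - π₀ / (1 - π₁)) / 2 ∧
      α ≤ (1 - π₁ / (1 - π₀)) / 2 ∧ 7 * α ≤ β * (1 - π₀ / (1 - π₁)) ^ 2 ∧
      7 * α ≤ β * (1 - π₁ / (1 - π₀)) ^ 2 := by
    have hc₀ : 0 < 1 - π₀ / (1 - π₁) := by linarith
    have hc₁ : 0 < 1 - π₁ / (1 - π₀) := by linarith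
    have hlim : ∀ b : ℝ, 0 < b → ∀ᶠ a in 𝓝[>] (0 : ℝ), a ≤ b := fun b hb =>
      ((tendsto_id.mono_left nhdsWithin_le_nhds : Tendsto id (𝓝[>] (0 : ℝ)) (𝓝 0)).eventually
        (eventually_le_nhds hb))
    obtain ⟨a, ⟨⟨⟨h1, h2⟩, h3⟩, h4⟩, h0⟩ := ((((hlim _ (half_pos hc₀)).and
      (hlim _ (half_pos hc₁))).and (hlim (β * (1 - π₀ / (1 - π₁)) ^ 2 / 7) (by positivity))).and
      (hlim (β * (1 - π₁ / (1 - π₀)) ^ 2 / 7) (by positivity))).and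
      (self_mem_nhdsWithin : Set.Ioi (0 : ℝ) ∈ 𝓝[>] (0 : ℝ)) |>.exists
    exact ⟨a, h0, h1, h2, by linarith, by linarith⟩
  -- consistency of the two estimated proportions
  have hlog0 : ∀ m n, 0 ≤ Real.log (1 / δ m n) := fun m n =>
    Real.log_nonneg (one_le_one_div (hδ m n).1 (hδ m n).2)
  -- The second proportion is estimated with the samples exchanged, hence at level δ(n, m); both
  -- samples must be uniformly close at both levels.
  have hlog_swap : Tendsto (fun p : ℕ × ℕ => Real.log (1 / δ p.2 p.1) / ((min p.1 p.2 : ℕ) : ℝ))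
      LabelNoise.minAtTop (𝓝 0) := by
    refine (hδ_log.comp LabelNoise.tendsto_swap_minAtTop).congr fun p => ?_
    simp only [Function.comp, Prod.fst_swap, Prod.snd_swap, min_comm]
  have hδ_swap : Tendsto (fun p : ℕ × ℕ => δ p.2 p.1) LabelNoise.minAtTop (𝓝 0) :=
    hδ_zero.comp LabelNoise.tendsto_swap_minAtTop
  have hmin := LabelNoise.tendsto_min_minAtTop
  have hmpe₀ := LabelNoise.eventually_abs_mpe_sub_le h𝓖_approx hκ₀' hκ₀.le
    (F := LabelNoise.mixture π₀ P₀ P₁) (H := LabelNoise.mixture π₁ P₁ P₀)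
    (fun f => by
      rw [LabelNoise.real_mixture_eq hπ₀ hπ₁ hA]
      exact le_add_of_nonneg_left (mul_nonneg (by linarith) measureReal_nonneg))
    (fun η hη => LabelNoise.exists_classifier_mixture hC.1 hπ₀ hπ₁ hA hη)
    LabelNoise.tendsto_fst_minAtTop LabelNoise.tendsto_snd_minAtTop (fun p => hδ p.1 p.2)
    (LabelNoise.tendsto_div_of_le (fun p => hlog0 _ _) hmin (fun p => min_le_left _ _) hδ_log)
    (LabelNoise.tendsto_div_of_le (fun p => hlog0 _ _) hmin (fun p => min_le_right _ _) hδ_log) hα0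
  have hmpe₁ := LabelNoise.eventually_abs_mpe_sub_le h𝓖_approx hκ₁' hκ₁.le
    (F := LabelNoise.mixture π₁ P₁ P₀) (H := LabelNoise.mixture π₀ P₀ P₁)
    (fun f => by
      rw [LabelNoise.real_mixture_eq hπ₁ hπ₀ hA']
      exact le_add_of_nonneg_left (mul_nonneg (by linarith) measureReal_nonneg))
    (fun η hη => LabelNoise.exists_classifier_mixture hC.2 hπ₁ hπ₀ hA' hη)
    LabelNoise.tendsto_snd_minAtTop LabelNoise.tendsto_fst_minAtTop (fun p => hδ p.2 p.1)
    (LabelNoise.tendsto_div_of_le (fun p => hlog0 _ _) hmin (fun p => min_le_right _ _) hlog_swap)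
    (LabelNoise.tendsto_div_of_le (fun p => hlog0 _ _) hmin (fun p => min_le_left _ _) hlog_swap)
    hα0
  -- a nearly optimal classifier, and its approximation in the classes
  obtain ⟨g, hg⟩ := LabelNoise.exists_maxError_lt P₀ P₁ hβ0
  have happrox := hk.eventually (hD.eventually_exists P₀ P₁ g hβ0)
  have hτβ := hk.eventually (hτ.eventually_lt_const hβ0)
  -- the outer probability of the exceptional samples
  have hbound := (LabelNoise.tendsto_failure_bound hδ_zero hδ_swap hmin
    (fun p => min_le_left p.1 p.2) hkV hα0).add
    (LabelNoise.tendsto_failure_bound hδ_zero hδ_swap hmin (fun p => min_le_right p.1 p.2) hkV hα0)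
  rw [add_zero] at hbound
  refine tendsto_of_tendsto_of_tendsto_of_le_of_le' tendsto_const_nhds hbound
    (Eventually.of_forall fun _ => zero_le) ?_
  filter_upwards [hmpe₀, hmpe₁, happrox, hτβ, LabelNoise.tendsto_fst_minAtTop.eventually_gt_atTop 0,
    LabelNoise.tendsto_snd_minAtTop.eventually_gt_atTop 0] with p hp₀ hp₁ hpf hpτ hm hn
  obtain ⟨f, hf, hf₀, hf₁⟩ := hpf
  refine (LabelNoise.measure_prod_le_add ?_).trans (add_le_add
    (LabelNoise.measure_not_close_le h𝓖_vc (fun j => (h𝓖_meas j).1) (h𝓕_vc _) (h𝓕_meas _).1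
      (hδ p.1 p.2) (hδ p.2 p.1) hα0.le hm)
    (LabelNoise.measure_not_close_le h𝓖_vc (fun j => (h𝓖_meas j).2) (h𝓕_vc _) (h𝓕_meas _).2
      (hδ p.1 p.2) (hδ p.2 p.1) hα0.le hn))
  rintro ⟨z₀, z₁⟩ hz
  by_contra hcon
  simp only [Set.mem_ofPred_eq, not_or, not_not] at hcon
  obtain ⟨⟨hU₀, hU₀', hF₀⟩, hU₁, hU₁', hF₁⟩ := hcon
  have hq₀ := hp₀ z₀ z₁ hU₀ hU₁
  have hq₁ := hp₁ z₁ z₀ hU₁' hU₀'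
  -- Since α ≤ (1-κ)/2, both estimated proportions are below 1, so the rule is an approximate
  -- minimizer here.
  have hmem := hfhat p.1 p.2 hm hn z₀ z₁ (by linarith [(abs_le.1 hq₀).2])
    (by linarith [(abs_le.1 hq₁).2])
  have h1 := LabelNoise.maxError_le_of_mem_approxMinimizers (P₀ := P₀) (P₁ := P₁) (β := β)
    (fun h hh => LabelNoise.abs_estMaxError_sub_le hπ₀ hπ₁ hA hn hα₀ hα₁ hβ₀ hβ₁ hq₀ hq₁
      (hF₀ h hh) (hF₁ h hh)) hmem hf
  have h2 := LabelNoise.maxError_le_add hf₀ hf₁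
  have h3 := LabelNoise.minmaxError_le P₀ P₁ (fhat p.1 p.2 z₀ z₁)
  have hz' : ε ≤ |LabelNoise.maxError P₀ P₁ (fhat p.1 p.2 z₀ z₁) - LabelNoise.minmaxError P₀ P₁| :=
    hz
  rw [abs_of_nonneg (by linarith)] at hz'
  linarith
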